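/- Let $r\ge 1$, and let $\boldsymbol m=(m_1,\dots,m_r)$, $\boldsymbol l=(l_1,\dots,l_r)$ be integer vectors and $k$ an integer; put $l_0=k$, $l_{r+1}=0$. Call $(\boldsymbol m,\boldsymbol l,k)$ \emph{consistent} if all $m_s,l_s,k$ are non-negative, $k\ge l_1\ge\dots\ge l_r\ge 0$, and $l_s-l_{s+1}\le m_s$ for $s=1,\dots,r$. For $0\le i\le r$ let $\boldsymbol 1_i=(1,\dots,1,0,\dots,0)\in\mathbb Z^r$ with $i$ ones, and put $$e_i(\boldsymbol l,k)=k+\sum_{s=1}^{i}m_s-l_i+l_{i+1}+i,\qquad e_i^\vee(\boldsymbol l,k)=\sum_{s=r+1-i}^{r}m_s-l_{r-i+1}+l_{r-i}+i .$$ For a finite-dimensional space $V\subset\mathbb C[x]$, the exponents of $V$ at $z\in\mathbb C$ are the orders of vanishing at $z$ of non-zero elements of $V$, the exponents at infinity are the degrees of non-zero elements of $V$, and $z$ is a singular point of $V$ if it is a root of the Wronskian of a basis of $V$. For consistent $(\boldsymbol m,\boldsymbol l,k)$ there is a unique $(r+1)$-dimensional space $V(\boldsymbol l,k)\subset\mathbb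 C[x]$ without singular points outside $\{0,1\}$ whose sets of exponents are $\{\,i+\sum_{s=1}^i m_s : 0\le i\le r\}$ at $0$, $\{0,k+1,k+2,\dots,k+r\}$ at $1$, and $\{e_0(\boldsymbol l,k),\dots,e_r(\boldsymbol l,k)\}$ at infinity. Likewise there is a unique $(r+1)$-dimensional space $U(\boldsymbol l,k)\subset\mathbb C[x]$ without singular points outside $\{0,1\}$ whose sets of exponents are $\{\,i+\sum_{s=r+1-i}^{r} m_s : 0\le i\le r\}$ at $0$, $\{0,1,\dots,r-1,k+r\}$ at $1$, and $\{e_0^\vee(\boldsymbol l,k),\dots,e_r^\vee(\boldsymbol l,k)\}$ at infinity. Let $i\in\{0,\dots,r\}$. The following hold, the existence and uniqueness of the spaces involved included. (1) If $(\boldsymbol m,\boldsymbol l,k)$ and $(\boldsymbol m,\boldsymbol l+\boldsymbol 1_i,k+1)$ are consistent, then the operator $$D_i(\boldsymbol l,k)=x(x-1)\frac{d}{dx}-e_i(\boldsymbol l,k)(x-1)-k-1$$ maps $V(\boldsymbol l,k)$ to $V(\boldsymbol l+\boldsymbol 1_i,k+1)$, and $D_i(\boldsymbol l,k):V(\boldsymbol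 l,k)\to V(\boldsymbol l+\boldsymbol 1_i,k+1)$ is an isomorphism of vector spaces. (2) If $(\boldsymbol m,\boldsymbol l-\boldsymbol 1_i,k-1)$ and $(\boldsymbol m,\boldsymbol l,k)$ are consistent, then the operator $$D_i^\vee(\boldsymbol l,k)=x\frac{d}{dx}-\Bigl(\sum_{s=i+1}^{r}m_s-l_{i+1}+l_i+r-i\Bigr)$$ maps $U(\boldsymbol l,k)$ to $U(\boldsymbol l-\boldsymbol 1_i,k-1)$, and $D_i^\vee(\boldsymbol l,k):U(\boldsymbol l,k)\to U(\boldsymbol l-\boldsymbol 1_i,k-1)$ is an isomorphism of vector spaces. -/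

import Mathlib

open Polynomial

noncomputable section

namespace TwoPoint

/-! Parameters `m = (m_1, …, m_r)`, `l = (l_1, …, l_r)`, `k` are integers; the entry with index
`s : Fin r` is `m_{s+1}`, respectively `l_{s+1}`. -/

/-- The extended sequence `l_0 = k, l_1, …, l_r, l_{r+1} = 0`. -/
def ext {r : ℕ} (l : Fin r → ℤ) (k : ℤ) : ℕ → ℤ
  | 0 => k
  | j + 1 => if h : j < r then l ⟨j, h⟩ else 0

/-- Consistent parameters: non-negative integers such that `k ≥ l_1 ≥ ⋯ ≥ l_r ≥ 0` and
`l_s - l_{s+1} ≤ m_s` for `s = 1, …, r`. -/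
structure Consistent {r : ℕ} (m l : Fin r → ℤ) (k : ℤ) : Prop where
  m_nonneg : ∀ s, 0 ≤ m s
  l_nonneg : ∀ s, 0 ≤ l s
  k_nonneg : 0 ≤ k
  antitone : ∀ j : ℕ, j ≤ r → ext l k (j + 1) ≤ ext l k j
  gap : ∀ s : Fin r, ext l k (s.val + 1) - ext l k (s.val + 2) ≤ m s

/-- The vector `1_i = (1, …, 1, 0, …, 0)` with `i` ones. -/
def ones {r : ℕ} (i : Fin (r + 1)) : Fin r → ℤ := fun s => if s.val < i.val then 1 else 0

/-- `e_i(m, l, k) = k + ∑_{s=1}^i m_s - l_i + l_{i+1} + i`. -/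
def expInf {r : ℕ} (m l : Fin r → ℤ) (k : ℤ) (i : Fin (r + 1)) : ℤ :=
  k + (∑ s : Fin r, if s.val < i.val then m s else 0)
    - ext l k i.val + ext l k (i.val + 1) + i.val

/-- `e_i^∨(m, l, k) = ∑_{s=r+1-i}^r m_s - l_{r-i+1} + l_{r-i} + i`. -/
def expInfDual {r : ℕ} (m l : Fin r → ℤ) (k : ℤ) (i : Fin (r + 1)) : ℤ :=
  (∑ s : Fin r, if r + 1 - i.val ≤ s.val + 1 then m s else 0)
    - ext l k (r - i.val + 1) + ext l k (r - i.val) + i.val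

/-- The set `{0, 1 + n_1, 2 + n_1 + n_2, …, r + n_1 + ⋯ + n_r}`. -/
def exponentSet {r : ℕ} (n : Fin r → ℤ) : Set ℤ :=
  Set.range fun i : Fin (r + 1) => (i.val : ℤ) + ∑ s : Fin r, if s.val < i.val then n s else 0

/-- The set of exponents at `z`: the orders of vanishing at `z` of non-zero elements of `V`. -/
def exponentsAt (V : Submodule ℂ ℂ[X]) (z : ℂ) : Set ℤ :=
  {a | ∃ f ∈ V, f ≠ 0 ∧ (f.rootMultiplicity z : ℤ) = a}

/-- The set of exponents at infinity: the degrees of non-zero elements of `V`. -/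
def exponentsAtInfinity (V : Submodule ℂ ℂ[X]) : Set ℤ :=
  {a | ∃ f ∈ V, f ≠ 0 ∧ (f.natDegree : ℤ) = a}

/-- The Wronskian of a tuple of polynomials. -/
def wronskian {n : ℕ} (f : Fin n → ℂ[X]) : ℂ[X] :=
  Matrix.det (Matrix.of fun i j : Fin n => derivative^[i.val] (f j))

/-- `z` is a singular point of `V` if it is a root of the Wronskian of a basis of `V`. Wronskians of
different bases differ by a non-zero constant factor, so the choice of basis is immaterial. -/
def IsSingularPoint (V : Submodule ℂ ℂ[X]) (z : ℂ) : Prop :=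
  ∃ b : Module.Basis (Fin (Module.finrank ℂ V)) ℂ V, (wronskian fun j => (b j : ℂ[X])).IsRoot z

/-- An `(r+1)`-dimensional space of polynomials without singular points outside `{0, 1}`, with sets
of exponents `E₀`, `E₁`, `E` at `0`, `1` and infinity. -/
structure IsTwoPointSpace (r : ℕ) (E₀ E₁ E : Set ℤ) (V : Submodule ℂ ℂ[X]) : Prop where
  finrank_eq : Module.finrank ℂ V = r + 1
  singular : ∀ z, IsSingularPoint V z → z = 0 ∨ z = 1
  exponents_zero : exponentsAt V 0 = E₀
  exponents_one : exponentsAt V 1 = E₁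
  exponents_infinity : exponentsAtInfinity V = E

/-- `V` is the space `V(m, l, k)`: here `n(0) = m` and `n(1) = (k, 0, …, 0)`. -/
def IsV {r : ℕ} (m l : Fin r → ℤ) (k : ℤ) (V : Submodule ℂ ℂ[X]) : Prop :=
  IsTwoPointSpace r (exponentSet m) (exponentSet fun s : Fin r => if s.val = 0 then k else 0)
    (Set.range (expInf m l k)) V

/-- `U` is the space `U(m, l, k)`: here `n(0) = (m_r, …, m_1)` and `n(1) = (0, …, 0, k)`. -/
def IsU {r : ℕ} (m l : Fin r → ℤ) (k : ℤ) (U : Submodule ℂ ℂ[X]) : Prop :=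
  IsTwoPointSpace r (exponentSet fun s : Fin r => m s.rev)
    (exponentSet fun s : Fin r => if s.val + 1 = r then k else 0)
    (Set.range (expInfDual m l k)) U

/-- `D_i(l, k) = x (x - 1) d/dx - e_i (x - 1) - k - 1`, acting on polynomials. -/
def D {r : ℕ} (m l : Fin r → ℤ) (k : ℤ) (i : Fin (r + 1)) : ℂ[X] →ₗ[ℂ] ℂ[X] :=
  LinearMap.mulLeft ℂ (X * (X - 1)) ∘ₗ derivative
    - (expInf m l k i : ℂ) • LinearMap.mulLeft ℂ (X - 1) - ((k : ℂ) + 1) • LinearMap.id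

/-- `D_i^∨(l, k) = x d/dx - (∑_{s=i+1}^r m_s - l_{i+1} + l_i + r - i)`, acting on polynomials. -/
def DDual {r : ℕ} (m l : Fin r → ℤ) (k : ℤ) (i : Fin (r + 1)) : ℂ[X] →ₗ[ℂ] ℂ[X] :=
  LinearMap.mulLeft ℂ X ∘ₗ derivative
    - (((∑ s : Fin r, if i.val < s.val + 1 then m s else 0)
      - ext l k (i.val + 1) + ext l k i.val + ((r : ℤ) - i.val) : ℤ) : ℂ) • LinearMap.id

end TwoPoint

end

noncomputable section

namespace TwoPoint

/-! ### Order and degree of a Wronskian. -/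

section Wronskian

/-! Each of the two spaces can be written down from a single solution, unique up to scalar, of a
linear system with one more unknown than equations. The operators carry such solutions to solutions.

For `U`, the exponents `a_i` at 0 and `b_i` at infinity satisfy `a_0 ≤ b_0 < a_1 ≤ b_1 < ⋯`, so a
dimension count gives a basis whose `i`-th element is supported on the block `[a_i, b_i]`. The
blocks contain `k + r + 1` exponents in all. A non-zero polynomial vanishes at 1 to order less than
its number of terms, so a polynomial `g` supported on the blocks with order `k + r` at 1 is unique
up to scalar and has no vanishing coefficient there. Hence `U` is spanned by the parts of `g` in the
blocks. The operator `x d/dx - b_i` is diagonal on monomials, so it commutes with cutting into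
blocks. It removes the monomial `x^{b_i}` and lowers the order at 1 by at most one, hence takes
generator to generator (`map_theta_blockSpace`).

For `V`, a dimension count gives a basis `p, (x-1)^(k+1) q_1, …, (x-1)^(k+1) q_r` with `deg p = l_1`
and `q_i` supported on `[a_{i-1}, b_i)`. An element of order `a_r` at 0 shows that `p / (x-1)^(k+1)`
agrees modulo `x^{a_r}` with a polynomial `H` supported on these intervals, a Padé-type condition.
The coefficients of `p / (1-x)^(k+1)` are the values at `0, 1, 2, …` of a polynomial of degree at
most `k`, and `k` of its zeros are known: the gaps between the intervals and some negative integers.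
One more zero makes everything vanish (`IsPadePair.eq_zero`), which gives uniqueness up to scalar
and the non-vanishing of the coefficients. Conjugation by `(x-1)^(k+1)` turns `D_i` into `x d/dx -
c` times a factor `x - 1`, which again shortens one interval (`map_padeOp_padeSpace`).

That the spaces so constructed have the right exponents and no further singular points follows from
Fuchs' relation (`sum_exponents_le`): the exponents known so far already exhaust the degree of the
Wronskian. -/

lemma wronskian_eq_C_mul {n : ℕ} {V : Submodule ℂ ℂ[X]} (b : Module.Basis (Fin n) ℂ V)
    (g : Fin n → ℂ[X]) (hg : ∀ j, g j ∈ V) :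
    ∃ c : ℂ, wronskian g = C c * wronskian fun j => (b j : ℂ[X]) := by
  refine ⟨(Matrix.of fun i j => b.repr ⟨g j, hg j⟩ i).det, ?_⟩
  rw [mul_comm, wronskian, wronskian, RingHom.map_det, ← Matrix.det_mul]
  congr 1
  ext1 i j
  have h : g j = ∑ t, C (b.repr ⟨g j, hg j⟩ t) * (b t : ℂ[X]) := by
    have h' := congrArg V.subtype (b.sum_repr ⟨g j, hg j⟩)
    rw [map_sum] at h'
    refine h'.symm.trans (Finset.sum_congr rfl fun t _ => ?_)
    rw [map_smul, smul_eq_C_mul, Submodule.subtype_apply]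
  simp only [Matrix.of_apply, Matrix.mul_apply, RingHom.mapMatrix_apply, Matrix.map_apply]
  conv_lhs => rw [h]
  rw [iterate_derivative_sum]
  refine Finset.sum_congr rfl fun t _ => ?_
  rw [iterate_derivative_C_mul, mul_comm]

/-- Scaling row `i` by `p ^ i` compensates the loss of order or degree in the `i`-th derivative, so
that estimates can be made column by column. It is used with `p = x - z` for orders and `p = x` for
degrees. -/
lemma pow_mul_wronskian {n : ℕ} (p : ℂ[X]) (f : Fin n → ℂ[X]) :
    p ^ (∑ i : Fin n, (i : ℕ)) * wronskian f =
      Matrix.det (Matrix.of fun i j : Fin n => p ^ (i : ℕ) * derivative^[i.val] (f j)) := by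
  rw [wronskian, ← Finset.prod_pow_eq_pow_sum,
    ← Matrix.det_mul_column (fun i : Fin n => p ^ (i : ℕ))]
  rfl

lemma X_sub_C_pow_dvd_pow_mul_wronskian {n : ℕ} (z : ℂ) (f : Fin n → ℂ[X]) (a : Fin n → ℕ)
    (h : ∀ j, (X - C z) ^ a j ∣ f j) :
    (X - C z) ^ (∑ j, a j) ∣ (X - C z) ^ (∑ i : Fin n, (i : ℕ)) * wronskian f := by
  rw [pow_mul_wronskian, Matrix.det_apply, ← Finset.prod_pow_eq_pow_sum]
  refine Finset.dvd_sum fun σ _ => Dvd.dvd.trans ?_ (dvd_smul_of_dvd _ dvd_rfl)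
  refine Finset.prod_dvd_prod_of_dvd _ _ fun j _ => ?_
  rw [Matrix.of_apply]
  refine (pow_dvd_pow _ (show a j ≤ σ j + (a j - σ j) by omega)).trans ?_
  rw [pow_add]
  exact mul_dvd_mul_left _ (pow_sub_dvd_iterate_derivative_of_pow_dvd _ (h j))

lemma coeff_prod_sum {ι : Type*} (s : Finset ι) (f : ι → ℂ[X]) (d : ι → ℕ)
    (h : ∀ i ∈ s, (f i).natDegree ≤ d i) :
    (∏ i ∈ s, f i).natDegree ≤ ∑ i ∈ s, d i ∧
      (∏ i ∈ s, f i).coeff (∑ i ∈ s, d i) = ∏ i ∈ s, (f i).coeff (d i) := by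
  classical
  induction s using Finset.induction_on with
  | empty => simp
  | insert i s hi ih =>
    obtain ⟨h1, h2⟩ := ih fun j hj => h j (Finset.mem_insert_of_mem hj)
    have h3 := h i (Finset.mem_insert_self i s)
    rw [Finset.prod_insert hi, Finset.sum_insert hi, Finset.prod_insert hi,
      coeff_mul_add_eq_of_natDegree_le h3 h1, h2]
    exact ⟨natDegree_mul_le_of_le h3 h1, rfl⟩

lemma natDegree_det_le {n : ℕ} (M : Matrix (Fin n) (Fin n) ℂ[X]) (d : Fin n → ℕ)
    (h : ∀ i j, (M i j).natDegree ≤ d j) :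
    M.det.natDegree ≤ ∑ j, d j ∧
      M.det.coeff (∑ j, d j) = Matrix.det (Matrix.of fun i j => (M i j).coeff (d j)) := by
  constructor
  · rw [Matrix.det_apply]
    refine natDegree_sum_le_of_forall_le _ _ fun σ _ => ?_
    refine (natDegree_smul_le _ _).trans ?_
    exact (coeff_prod_sum _ _ d fun i _ => h _ i).1
  · rw [Matrix.det_apply, Matrix.det_apply, finsetSum_coeff]
    refine Finset.sum_congr rfl fun σ _ => ?_
    rw [coeff_smul, (coeff_prod_sum _ _ d fun i _ => h _ i).2]
    rfl

lemma coeff_X_pow_mul_iterate_derivative (f : ℂ[X]) (i n : ℕ) :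
    (X ^ i * derivative^[i] f).coeff n = (n.descFactorial i : ℂ) * f.coeff n := by
  rw [coeff_X_pow_mul']
  split_ifs with h
  · rw [coeff_iterate_derivative, Nat.sub_add_cancel h, nsmul_eq_mul]
  · rw [Nat.descFactorial_of_lt (not_le.mp h)]
    simp

/-- Since `x^i (d/dx)^i` multiplies `x^n` by a falling factorial of `n`, the coefficient of the
scaled determinant at the sum of the degrees is the product of the leading coefficients and a
determinant of falling factorials. The latter is the Vandermonde determinant of the distinct
degrees. -/
lemma wronskian_natDegree {n : ℕ} (f : Fin n → ℂ[X]) (hf : ∀ j, f j ≠ 0)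
    (hinj : Function.Injective fun j => (f j).natDegree) :
    wronskian f ≠ 0 ∧
      (∑ i : Fin n, (i : ℕ)) + (wronskian f).natDegree ≤ ∑ j, (f j).natDegree := by
  have key := natDegree_det_le
    (Matrix.of fun i j : Fin n => X ^ (i : ℕ) * derivative^[i.val] (f j))
    (fun j => (f j).natDegree) (by
      intro i j
      rw [natDegree_le_iff_coeff_eq_zero]
      intro N hN
      rw [Matrix.of_apply, coeff_X_pow_mul_iterate_derivative, coeff_eq_zero_of_natDegree_lt hN,
        mul_zero])
  rw [← pow_mul_wronskian] at key
  have hdet : Matrix.det (Matrix.of fun i j : Fin n =>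
      ((Matrix.of fun i j : Fin n => X ^ (i : ℕ) * derivative^[i.val] (f j)) i j).coeff
        ((f j).natDegree)) ≠ 0 := by
    have h1 : (Matrix.of fun i j : Fin n =>
      ((Matrix.of fun i j : Fin n => X ^ (i : ℕ) * derivative^[i.val] (f j)) i j).coeff
        ((f j).natDegree)) = Matrix.of fun i j : Fin n => (f j).leadingCoeff *
          (Matrix.of fun a b : Fin n =>
            (descPochhammer ℂ b).eval ((f a).natDegree : ℂ)).transpose i j := by
      ext i j
      simp only [Matrix.of_apply, Matrix.transpose_apply]
      rw [coeff_X_pow_mul_iterate_derivative, descPochhammer_eval_eq_descFactorial, mul_comm]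
      rfl
    rw [h1, Matrix.det_mul_row, Matrix.det_transpose,
      ← Matrix.det_eval_matrixOfPolynomials_eq_det_vandermonde
        (fun a => ((f a).natDegree : ℂ)) (fun b => descPochhammer ℂ b)
        (fun i => descPochhammer_natDegree _ _) (fun i => monic_descPochhammer _ _)]
    refine mul_ne_zero (Finset.prod_ne_zero_iff.mpr fun i _ => leadingCoeff_ne_zero.mpr (hf i)) ?_
    rw [Matrix.det_vandermonde_ne_zero_iff]
    intro a b hab
    exact hinj (by simpa using hab)
  rw [← key.2] at hdet
  have hne : X ^ (∑ i : Fin n, (i : ℕ)) * wronskian f ≠ 0 := by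
    intro h
    rw [h] at hdet
    simp at hdet
  have hw : wronskian f ≠ 0 := right_ne_zero_of_mul hne
  refine ⟨hw, ?_⟩
  have := key.1
  rwa [natDegree_mul (pow_ne_zero _ X_ne_zero) hw, natDegree_X_pow] at this

end Wronskian

/-! ### Exponents as leading indices, treated uniformly for degree and order of vanishing. -/

section Exponents

/-- `v` assigns to a non-zero polynomial the index of its leading term with respect to the
coefficient functionals `φ`, indices being ordered through `ρ`. -/
structure IsLeadingIndex (v : ℂ[X] → ℕ) (φ : ℕ → ℂ[X] →ₗ[ℂ] ℂ) (ρ : ℕ → ℤ) : Prop where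
  injective : Function.Injective ρ
  apply_ne_zero : ∀ f, f ≠ 0 → φ (v f) f ≠ 0
  apply_eq_zero : ∀ f n, f ≠ 0 → ρ n < ρ (v f) → φ n f = 0

lemma isLeadingIndex_natDegree :
    IsLeadingIndex natDegree (fun n => lcoeff ℂ n) (fun n => -(n : ℤ)) where
  injective a b h := by simpa using h
  apply_ne_zero f hf := by simpa using hf
  apply_eq_zero f n _ h := by
    have : f.natDegree < n := by omega
    simpa using coeff_eq_zero_of_natDegree_lt this

lemma isLeadingIndex_rootMultiplicity (z : ℂ) :
    IsLeadingIndex (rootMultiplicity z) (fun n => lcoeff ℂ n ∘ₗ taylor z) (fun n => (n : ℤ)) where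
  injective a b h := by simpa using h
  apply_ne_zero f hf := by
    have h : rootMultiplicity z f = (taylor z f).natTrailingDegree :=
      rootMultiplicity_eq_natTrailingDegree
    rw [h]
    change (taylor z f).trailingCoeff ≠ 0
    rw [trailingCoeff_nonzero_iff_nonzero]
    exact fun h => hf (taylor_injective z (by rw [h, map_zero]))
  apply_eq_zero f n hf hn := by
    have h : rootMultiplicity z f = (taylor z f).natTrailingDegree :=
      rootMultiplicity_eq_natTrailingDegree
    have hn' : n < rootMultiplicity z f := by exact_mod_cast hn
    exact coeff_eq_zero_of_lt_natTrailingDegree (h ▸ hn')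

variable {v : ℂ[X] → ℕ} {φ : ℕ → ℂ[X] →ₗ[ℂ] ℂ} {ρ : ℕ → ℤ}

lemma IsLeadingIndex.linearIndependent (hv : IsLeadingIndex v φ ρ) {ι : Type*} [Finite ι]
    (f : ι → ℂ[X]) (hf : ∀ i, f i ≠ 0) (hinj : Function.Injective fun i => v (f i)) :
    LinearIndependent ℂ f := by
  classical
  have := Fintype.ofFinite ι
  rw [Fintype.linearIndependent_iff]
  intro c hc
  by_contra! hne
  obtain ⟨i, hi⟩ := hne
  -- Among the terms with non-zero coefficient, the one whose leading index is first in the order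
  -- `ρ` is the only one seen by the functional at that index.
  obtain ⟨j, hj, hmin⟩ := Finset.exists_min_image (Finset.univ.filter fun i => c i ≠ 0)
    (fun i => ρ (v (f i))) ⟨i, by simpa using hi⟩
  have hj' : c j ≠ 0 := by simpa using hj
  have h := congrArg (φ (v (f j))) hc
  rw [map_sum, map_zero, Finset.sum_eq_single j] at h
  · rw [map_smul, smul_eq_mul] at h
    exact mul_ne_zero hj' (hv.apply_ne_zero _ (hf j)) h
  · intro t _ htj
    rw [map_smul, smul_eq_mul]
    by_cases ht : c t = 0
    · rw [ht, zero_mul]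
    · rw [hv.apply_eq_zero _ _ (hf t), mul_zero]
      refine lt_of_le_of_ne (hmin t (by simpa using ht)) fun h => htj ?_
      exact hinj (hv.injective h.symm)
  · simp

/-- The values of `v` on the non-zero elements of `V`. -/
def indexSet (v : ℂ[X] → ℕ) (V : Submodule ℂ ℂ[X]) : Set ℕ := {a | ∃ f ∈ V, f ≠ 0 ∧ v f = a}

lemma indexSet_mono {V W : Submodule ℂ ℂ[X]} (h : V ≤ W) : indexSet v V ⊆ indexSet v W :=
  fun _ ⟨f, hf, h0, ha⟩ => ⟨f, h hf, h0, ha⟩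

lemma exponentsAt_eq (V : Submodule ℂ ℂ[X]) (z : ℂ) :
    exponentsAt V z = (Nat.cast : ℕ → ℤ) '' indexSet (rootMultiplicity z) V := by
  ext a
  constructor
  · rintro ⟨f, hf, h0, rfl⟩
    exact ⟨_, ⟨f, hf, h0, rfl⟩, rfl⟩
  · rintro ⟨_, ⟨f, hf, h0, rfl⟩, rfl⟩
    exact ⟨f, hf, h0, rfl⟩

lemma exponentsAtInfinity_eq (V : Submodule ℂ ℂ[X]) :
    exponentsAtInfinity V = (Nat.cast : ℕ → ℤ) '' indexSet natDegree V := by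
  ext a
  constructor
  · rintro ⟨f, hf, h0, rfl⟩
    exact ⟨_, ⟨f, hf, h0, rfl⟩, rfl⟩
  · rintro ⟨_, ⟨f, hf, h0, rfl⟩, rfl⟩
    exact ⟨f, hf, h0, rfl⟩

lemma IsLeadingIndex.card_le (hv : IsLeadingIndex v φ ρ) (V : Submodule ℂ ℂ[X])
    [FiniteDimensional ℂ V] (E : Finset ℕ) (hE : ↑E ⊆ indexSet v V) :
    E.card ≤ Module.finrank ℂ V := by
  have hE' : ∀ a : E, ∃ f ∈ V, f ≠ 0 ∧ v f = a := fun a => hE a.2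
  choose f hfV hf0 hfv using hE'
  have h := hv.linearIndependent f hf0 fun a b hab => Subtype.ext (by simpa [hfv] using hab)
  have h' : LinearIndependent ℂ (fun a => (⟨f a, hfV a⟩ : V)) :=
    LinearIndependent.of_comp V.subtype h
  simpa using h'.fintype_card_le_finrank

/-- Elements with distinct indices are independent, which bounds the number of indices. Conversely
the functionals at the attained indices are jointly injective on `V`. -/
lemma IsLeadingIndex.exists_finset (hv : IsLeadingIndex v φ ρ) (V : Submodule ℂ ℂ[X])
    [FiniteDimensional ℂ V] :
    ∃ E : Finset ℕ, ↑E = indexSet v V ∧ E.card = Module.finrank ℂ V := by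
  have hfin : (indexSet v V).Finite := by
    by_contra hinf
    obtain ⟨E, hE, hcard⟩ := Set.Infinite.exists_subset_card_eq hinf (Module.finrank ℂ V + 1)
    have := hv.card_le V E hE
    omega
  refine ⟨hfin.toFinset, hfin.coe_toFinset, le_antisymm (hv.card_le V _ (by simp)) ?_⟩
  let T : V →ₗ[ℂ] (hfin.toFinset → ℂ) := LinearMap.pi fun a => φ a ∘ₗ V.subtype
  have hT : Function.Injective T := by
    rw [injective_iff_map_eq_zero]
    intro f hf
    by_contra h0
    have h0' : (f : ℂ[X]) ≠ 0 := fun h => h0 (Subtype.ext h)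
    have hmem : v f ∈ hfin.toFinset := by
      rw [Set.Finite.mem_toFinset]
      exact ⟨f, f.2, h0', rfl⟩
    exact hv.apply_ne_zero f h0' (congrFun hf ⟨v f, hmem⟩)
  simpa using LinearMap.finrank_le_finrank_of_injective hT

lemma IsLeadingIndex.indexSet_eq (hv : IsLeadingIndex v φ ρ) (V : Submodule ℂ ℂ[X])
    [FiniteDimensional ℂ V] (E : Finset ℕ) (hE : ↑E ⊆ indexSet v V)
    (hcard : Module.finrank ℂ V ≤ E.card) : indexSet v V = E := by
  obtain ⟨F, hF, hFc⟩ := hv.exists_finset V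
  rw [← hF] at hE ⊢
  rw [Finset.eq_of_subset_of_card_le (Finset.coe_subset.mp hE) (hFc.trans_le hcard)]

lemma IsLeadingIndex.exists_basis (hv : IsLeadingIndex v φ ρ) (V : Submodule ℂ ℂ[X])
    [FiniteDimensional ℂ V]
    {n : ℕ} (hn : Module.finrank ℂ V = n) (E : Finset ℕ)
    (hE : ↑E = indexSet v V) (hcard : E.card = n) :
    ∃ b : Module.Basis (Fin n) ℂ V, (Function.Injective fun i => v (b i)) ∧
      ∑ i, v (b i) = ∑ a ∈ E, a := by
  let e : Fin n ≃ E := (finCongr hcard.symm).trans E.equivFin.symm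
  have hE' : ∀ i : Fin n, ∃ f ∈ V, f ≠ 0 ∧ v f = e i := fun i => hE.subset (e i).2
  choose f hfV hf0 hfv using hE'
  have hinj : Function.Injective fun i => v (f i) := fun a b hab =>
    e.injective (Subtype.ext (by simpa [hfv] using hab))
  have h := hv.linearIndependent f hf0 hinj
  have h' : LinearIndependent ℂ (fun a => (⟨f a, hfV a⟩ : V)) :=
    LinearIndependent.of_comp V.subtype h
  obtain ⟨b, hb⟩ : ∃ b : Module.Basis (Fin n) ℂ V, ∀ i, (b i : ℂ[X]) = f i := by
    rcases n with _ | n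
    · have : Subsingleton V := Module.finrank_zero_iff.mp hn
      exact ⟨Module.Basis.empty V, fun i => i.elim0⟩
    · refine ⟨basisOfLinearIndependentOfCardEqFinrank h' (by simp [hn]), fun i => ?_⟩
      rw [coe_basisOfLinearIndependentOfCardEqFinrank]
  refine ⟨b, ?_, ?_⟩
  · simpa only [hb] using hinj
  · simp only [hb, hfv]
    rw [Equiv.sum_comp e fun a : E => (a : ℕ), Finset.sum_coe_sort E fun a => a]

end Exponents

/-! ### Fuchs' relation. -/

section Fuchs

/-- Fuchs' relation for spaces of polynomials. -/
theorem sum_exponents_le (V : Submodule ℂ ℂ[X]) [FiniteDimensional ℂ V] {n : ℕ} (hn : Module.finrank ℂ V = n)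
    (E₀ E₁ E : Finset ℕ) (h₀ : ↑E₀ = indexSet (rootMultiplicity 0) V)
    (h₁ : ↑E₁ = indexSet (rootMultiplicity 1) V) (h : ↑E = indexSet natDegree V)
    (c₀ : E₀.card = n) (c₁ : E₁.card = n) (c : E.card = n) :
    ∑ a ∈ E₀, a + ∑ a ∈ E₁, a ≤ ∑ a ∈ E, a + ∑ i ∈ Finset.range n, i ∧
      (∑ a ∈ E, a + ∑ i ∈ Finset.range n, i ≤ ∑ a ∈ E₀, a + ∑ a ∈ E₁, a →
        ∀ z, IsSingularPoint V z → z = 0 ∨ z = 1) := by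
  -- One basis is adapted to each of 0, 1 and infinity. Their Wronskians agree up to constants, so
  -- all three estimates apply to the same polynomial `W`.
  obtain ⟨b₀, -, s₀⟩ := (isLeadingIndex_rootMultiplicity 0).exists_basis V hn E₀ h₀ c₀
  obtain ⟨b₁, -, s₁⟩ := (isLeadingIndex_rootMultiplicity 1).exists_basis V hn E₁ h₁ c₁
  obtain ⟨b, hb, s⟩ := isLeadingIndex_natDegree.exists_basis V hn E h c
  have hne : ∀ j, (b j : ℂ[X]) ≠ 0 := fun j h => b.ne_zero j (Subtype.ext h)
  obtain ⟨hW, hdeg⟩ := wronskian_natDegree (fun j => (b j : ℂ[X])) hne hb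
  set W := wronskian fun j => (b j : ℂ[X])
  have hord : ∀ (z : ℂ) (b' : Module.Basis (Fin n) ℂ V),
      (X - C z) ^ (∑ j, rootMultiplicity z (b' j : ℂ[X])) ∣
        (X - C z) ^ (∑ i : Fin n, (i : ℕ)) * W := by
    intro z b'
    obtain ⟨c, hc⟩ := wronskian_eq_C_mul b' (fun j => (b j : ℂ[X])) fun j => (b j).2
    change W = _ at hc
    rw [hc, mul_left_comm]
    exact (X_sub_C_pow_dvd_pow_mul_wronskian z _ _ fun j => pow_rootMultiplicity_dvd _ _).mul_left _
  have hord' : ∀ (z : ℂ) (b' : Module.Basis (Fin n) ℂ V),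
      ∑ j, rootMultiplicity z (b' j : ℂ[X]) ≤ ∑ i : Fin n, (i : ℕ) + rootMultiplicity z W := by
    intro z b'
    have hne' : (X - C z) ^ (∑ i : Fin n, (i : ℕ)) * W ≠ 0 :=
      mul_ne_zero (pow_ne_zero _ (X_sub_C_ne_zero z)) hW
    have := (le_rootMultiplicity_iff hne').mpr (hord z b')
    rwa [rootMultiplicity_mul hne', rootMultiplicity_X_sub_C_pow] at this
  have o₀ := hord' 0 b₀
  have o₁ := hord' 1 b₁
  rw [s₀] at o₀
  rw [s₁] at o₁
  simp only [s] at hdeg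
  rw [Finset.sum_range]
  -- Applied to `{0, 1}` this gives the inequality. In the case of equality, `{z, 0, 1}` leaves no
  -- room for a third root.
  have hcount : ∀ s : Finset ℂ, ∑ z ∈ s, rootMultiplicity z W ≤ W.natDegree := by
    intro s
    calc ∑ z ∈ s, rootMultiplicity z W = ∑ z ∈ s, W.roots.count z := by simp
      _ ≤ ∑ z ∈ s ∪ W.roots.toFinset, W.roots.count z :=
        Finset.sum_le_sum_of_subset Finset.subset_union_left
      _ = W.roots.card := Multiset.sum_count_eq_card fun z hz =>
        Finset.mem_union_right _ (Multiset.mem_toFinset.mpr hz)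
      _ ≤ W.natDegree := W.card_roots'
  refine ⟨?_, fun heq z hz => ?_⟩
  · have := hcount {0, 1}
    rw [Finset.sum_pair zero_ne_one] at this
    omega
  · by_contra! hz01
    have hroot : 0 < rootMultiplicity z W := by
      rw [rootMultiplicity_pos hW]
      obtain ⟨b', hb'⟩ := hz
      obtain ⟨c, hc⟩ := wronskian_eq_C_mul (b'.reindex (finCongr hn)) (fun j => (b j : ℂ[X]))
        fun j => (b j).2
      have hb'' : (wronskian fun j => ((b'.reindex (finCongr hn)) j : ℂ[X])).IsRoot z := by
        clear_value W
        subst hn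
        simpa using hb'
      change W = _ at hc
      rw [hc, IsRoot.def, eval_mul, hb''.eq_zero, mul_zero]
    have := hcount {z, 0, 1}
    rw [Finset.sum_insert (by simp [hz01.1, hz01.2]), Finset.sum_pair zero_ne_one] at this
    omega

end Fuchs

/-! ### Dimension counts, the operator `x d/dx - c`, and orders of vanishing at 0 and 1. -/

section Auxiliary

lemma exists_ne_zero_of_card_lt {M ι : Type*} [AddCommGroup M] [Module ℂ M]
    [FiniteDimensional ℂ M] [Fintype ι] (φ : ι → M →ₗ[ℂ] ℂ)
    (h : Fintype.card ι < Module.finrank ℂ M) : ∃ x ≠ 0, ∀ i, φ i x = 0 := by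
  have hker : LinearMap.ker (LinearMap.pi φ) ≠ ⊥ :=
    LinearMap.ker_ne_bot_of_finrank_lt (by simpa using h)
  obtain ⟨x, hx, h0⟩ := (Submodule.ne_bot_iff _).mp hker
  exact ⟨x, h0, fun i => congrFun (LinearMap.mem_ker.mp hx) i⟩

lemma exists_mem_of_card_lt {ι : Type*} [Fintype ι] (V : Submodule ℂ ℂ[X])
    [FiniteDimensional ℂ V] (φ : ι → ℂ[X] →ₗ[ℂ] ℂ) (h : Fintype.card ι < Module.finrank ℂ V) :
    ∃ f ∈ V, f ≠ 0 ∧ ∀ i, φ i f = 0 := by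
  obtain ⟨x, h0, hx⟩ := exists_ne_zero_of_card_lt (fun i => φ i ∘ₗ V.subtype) h
  exact ⟨x, x.2, fun h => h0 (Subtype.ext h), hx⟩

lemma span_range_eq_of_linearIndependent {V : Submodule ℂ ℂ[X]} {n : ℕ} [FiniteDimensional ℂ V]
    (hn : Module.finrank ℂ V = n) {f : Fin n → ℂ[X]} (hf : LinearIndependent ℂ f)
    (hV : ∀ i, f i ∈ V) : Submodule.span ℂ (Set.range f) = V := by
  refine Submodule.eq_of_le_of_finrank_eq (Submodule.span_le.mpr ?_) ?_
  · rintro _ ⟨i, rfl⟩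
    exact hV i
  · rw [finrank_span_eq_card hf, hn, Fintype.card_fin]

/-- A linear map carrying `V` onto a space of the same finite dimension is an isomorphism on `V`. -/
lemma exists_linearEquiv_of_map_eq {V W : Submodule ℂ ℂ[X]} [FiniteDimensional ℂ V]
    [FiniteDimensional ℂ W] (T : ℂ[X] →ₗ[ℂ] ℂ[X]) (hT : V.map T = W)
    (hfin : Module.finrank ℂ V = Module.finrank ℂ W) :
    ∃ φ : V ≃ₗ[ℂ] W, ∀ f : V, (φ f : ℂ[X]) = T f := by
  have hmem : ∀ f ∈ V, T f ∈ W := fun f hf => hT ▸ Submodule.mem_map_of_mem hf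
  have hsurj : Function.Surjective (T.restrict hmem) := by
    rintro ⟨g, hg⟩
    rw [← hT] at hg
    obtain ⟨f, hf, rfl⟩ := hg
    exact ⟨⟨f, hf⟩, rfl⟩
  have hinj := (LinearMap.injective_iff_surjective_of_finrank_eq_finrank hfin).mpr hsurj
  exact ⟨LinearEquiv.ofBijective _ ⟨hinj, hsurj⟩, fun f => rfl⟩

/-- The part of a polynomial supported on `s`. -/
def cut (s : Finset ℕ) : ℂ[X] →ₗ[ℂ] ℂ[X] := ∑ n ∈ s, monomial n ∘ₗ lcoeff ℂ n

lemma coeff_cut (s : Finset ℕ) (f : ℂ[X]) (n : ℕ) :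
    (cut s f).coeff n = if n ∈ s then f.coeff n else 0 := by
  simp [cut, finsetSum_coeff, coeff_monomial]

/-- The polynomial with the given coefficients at the exponents in `s`. -/
def ofCoeffs (s : Finset ℕ) : (s → ℂ) →ₗ[ℂ] ℂ[X] :=
  ∑ n : s, monomial (n : ℕ) ∘ₗ LinearMap.proj n

lemma coeff_ofCoeffs (s : Finset ℕ) (x : s → ℂ) (n : ℕ) :
    (ofCoeffs s x).coeff n = if hn : n ∈ s then x ⟨n, hn⟩ else 0 := by
  simp only [ofCoeffs, LinearMap.sum_apply, LinearMap.comp_apply, LinearMap.proj_apply,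
    finsetSum_coeff, coeff_monomial]
  split_ifs with hn
  · rw [Finset.sum_eq_single ⟨n, hn⟩]
    · simp
    · intro t _ ht
      rw [if_neg fun h => ht (Subtype.ext h)]
    · simp
  · refine Finset.sum_eq_zero fun t _ => if_neg ?_
    rintro rfl
    exact hn t.2

lemma ofCoeffs_injective (s : Finset ℕ) : Function.Injective (ofCoeffs s) := by
  intro x y h
  ext n
  have := congrArg (fun f => f.coeff n) h
  simpa [coeff_ofCoeffs] using this

lemma support_ofCoeffs_subset (s : Finset ℕ) (x : s → ℂ) : (ofCoeffs s x).support ⊆ s := by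
  intro n hn
  by_contra hn'
  rw [mem_support_iff, coeff_ofCoeffs, dif_neg hn'] at hn
  exact hn rfl

/-- The operator `x d/dx - c`. -/
def theta (c : ℂ) : ℂ[X] →ₗ[ℂ] ℂ[X] := LinearMap.mulLeft ℂ X ∘ₗ derivative - c • LinearMap.id

lemma theta_apply (c : ℂ) (f : ℂ[X]) : theta c f = X * derivative f - C c * f := by
  simp [theta, smul_eq_C_mul]

lemma coeff_theta (c : ℂ) (f : ℂ[X]) (n : ℕ) :
    (theta c f).coeff n = ((n : ℂ) - c) * f.coeff n := by
  rw [theta_apply, coeff_sub, coeff_C_mul]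
  rcases n with _ | n
  · simp
  · rw [coeff_X_mul, coeff_derivative]
    push_cast
    ring

lemma theta_cut (c : ℂ) (s : Finset ℕ) (f : ℂ[X]) : theta c (cut s f) = cut s (theta c f) := by
  ext n
  simp [coeff_theta, coeff_cut]

lemma X_sub_one_pow_dvd_theta {N : ℕ} {f : ℂ[X]} (c : ℂ) (h : (X - 1) ^ (N + 1) ∣ f) :
    (X - 1) ^ N ∣ theta c f := by
  rw [theta_apply]
  refine dvd_sub (Dvd.dvd.mul_left ?_ _) (Dvd.dvd.mul_left ((pow_dvd_pow _ N.le_succ).trans h) _)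
  simpa using pow_sub_dvd_iterate_derivative_of_pow_dvd 1 h

/-- The order of vanishing at `1` of a non-zero polynomial is smaller than its number of terms. -/
lemma lt_card_support_of_X_sub_one_pow_dvd (N : ℕ) :
    ∀ f : ℂ[X], f ≠ 0 → (X - 1) ^ N ∣ f → N < f.support.card := by
  induction N with
  | zero => exact fun f hf _ => Finset.card_pos.mpr (nonempty_support_iff.mpr hf)
  | succ N ih =>
    intro f hf h
    obtain ⟨n, hn⟩ := nonempty_support_iff.mpr hf
    -- The operator `x d/dx - n` removes exactly one term and costs at most one order of vanishing
    -- at 1. The result is non-zero because a monomial does not vanish at 1.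
    have hsupp : (theta n f).support = f.support.erase n := by
      ext t
      simp [coeff_theta, sub_eq_zero]
    have hne : theta n f ≠ 0 := by
      intro h0
      have hf' : f = C (f.coeff n) * X ^ n := by
        ext t
        rw [coeff_C_mul_X_pow]
        split_ifs with ht
        · rw [ht]
        · by_contra hc
          have : t ∈ (theta n f).support := by
            rw [hsupp, Finset.mem_erase]
            exact ⟨ht, mem_support_iff.mpr hc⟩
          simp [h0] at this
      have h1 : (X - C 1 : ℂ[X]) ∣ f := by
        rw [C_1]
        exact (dvd_pow_self _ N.succ_ne_zero).trans h
      rw [dvd_iff_isRoot, IsRoot.def, hf'] at h1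
      simp at h1
      exact mem_support_iff.mp hn h1
    have := ih _ hne (X_sub_one_pow_dvd_theta _ h)
    rw [hsupp, Finset.card_erase_of_mem hn] at this
    omega

lemma coeff_eq_zero_of_lt_rootMultiplicity {f : ℂ[X]} {n : ℕ} (h : n < rootMultiplicity 0 f) :
    f.coeff n = 0 := by
  rw [rootMultiplicity_eq_natTrailingDegree'] at h
  exact coeff_eq_zero_of_lt_natTrailingDegree h

lemma coeff_rootMultiplicity_ne_zero {f : ℂ[X]} (h : f ≠ 0) :
    f.coeff (rootMultiplicity 0 f) ≠ 0 := by
  rw [rootMultiplicity_eq_natTrailingDegree']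
  exact trailingCoeff_nonzero_iff_nonzero.mpr h

lemma rootMultiplicity_zero_eq {f : ℂ[X]} {n : ℕ} (h : f.coeff n ≠ 0)
    (h' : ∀ t < n, f.coeff t = 0) : rootMultiplicity 0 f = n := by
  have hf : f ≠ 0 := fun h0 => h (by simp [h0])
  refine le_antisymm ?_ ?_
  · by_contra! hlt
    exact h (coeff_eq_zero_of_lt_rootMultiplicity hlt)
  · by_contra! hlt
    exact coeff_rootMultiplicity_ne_zero hf (h' _ hlt)

/-- The equality case turns the bounds from Fuchs' relation into an exact determination of the
exponents at 1. -/
lemma sum_range_add_le (s : Finset ℕ) : ∀ m, (∀ x ∈ s, m ≤ x) →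
    ∑ i ∈ Finset.range s.card, (m + i) ≤ ∑ x ∈ s, x ∧
      (∑ x ∈ s, x ≤ ∑ i ∈ Finset.range s.card, (m + i) → s = Finset.Ico m (m + s.card)) := by
  induction s using Finset.induction_on_max with
  | empty => simp
  | insert x s hx ih =>
    intro m hm
    have hxs : x ∉ s := fun h => lt_irrefl _ (hx x h)
    obtain ⟨h1, h2⟩ := ih m fun y hy => hm y (Finset.mem_insert_of_mem hy)
    have hle : m + s.card ≤ x := by
      have : s ⊆ Finset.Ico m x := fun y hy =>
        Finset.mem_Ico.mpr ⟨hm y (Finset.mem_insert_of_mem hy), hx y hy⟩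
      have := Finset.card_le_card this
      have := hm x (Finset.mem_insert_self x s)
      rw [Nat.card_Ico] at *
      omega
    rw [Finset.card_insert_of_notMem hxs, Finset.sum_insert hxs, Finset.sum_range_succ]
    refine ⟨by omega, fun h => ?_⟩
    rw [h2 (by omega)]
    ext y
    simp only [Finset.mem_insert, Finset.mem_Ico, Nat.card_Ico]
    omega

end Auxiliary

/-! ### The spaces `U`: polynomials supported on interlaced blocks. -/

section Interlaced

variable {r : ℕ}

/-- The pattern `a_0 ≤ b_0 < a_1 ≤ b_1 < ⋯ < a_r ≤ b_r` with `∑ (b_i - a_i) = k`. -/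
structure Interlaced (a b : Fin (r + 1) → ℕ) (k : ℕ) : Prop where
  le : ∀ i, a i ≤ b i
  lt : ∀ i j, i < j → b i < a j
  sum : ∑ i, b i = ∑ i, a i + k

/-- The union of the intervals `[a_i, b_i]`. -/
def blocks (a b : Fin (r + 1) → ℕ) : Finset ℕ := Finset.univ.biUnion fun i => Finset.Icc (a i) (b i)

lemma mem_blocks {a b : Fin (r + 1) → ℕ} {n : ℕ} : n ∈ blocks a b ↔ ∃ i, a i ≤ n ∧ n ≤ b i := by
  simp [blocks]

variable {a b : Fin (r + 1) → ℕ} {k : ℕ}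

lemma Interlaced.eq_of_mem (h : Interlaced a b k) {i j : Fin (r + 1)} {n : ℕ} (h1 : a i ≤ n)
    (h2 : n ≤ b i) (h3 : a j ≤ n) (h4 : n ≤ b j) : i = j := by
  rcases lt_trichotomy i j with hij | hij | hij
  · have := h.lt i j hij
    omega
  · exact hij
  · have := h.lt j i hij
    omega

lemma Interlaced.strictMono_left (h : Interlaced a b k) : StrictMono a :=
  fun i j hij => (h.le i).trans_lt (h.lt i j hij)

lemma Interlaced.strictMono_right (h : Interlaced a b k) : StrictMono b :=
  fun i j hij => (h.lt i j hij).trans_le (h.le j)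

lemma Interlaced.card_blocks (h : Interlaced a b k) : (blocks a b).card = k + r + 1 := by
  rw [blocks, Finset.card_biUnion]
  · have h1 : ∑ i, ((Finset.Icc (a i) (b i)).card + a i) = ∑ i, (b i + 1) :=
      Finset.sum_congr rfl fun i _ => by
        rw [Nat.card_Icc]
        have := h.le i
        omega
    rw [Finset.sum_add_distrib, Finset.sum_add_distrib, h.sum] at h1
    simp only [Finset.sum_const, Finset.card_univ, Fintype.card_fin, smul_eq_mul] at h1
    omega
  · intro i _ j _ hij
    refine Finset.disjoint_left.mpr fun n hi hj => ?_
    rw [Finset.mem_Icc] at hi hj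
    exact hij (h.eq_of_mem hi.1 hi.2 hj.1 hj.2)

/-- A polynomial supported on the blocks with the largest possible order of vanishing at `1`. -/
structure IsBlockGenerator (a b : Fin (r + 1) → ℕ) (k : ℕ) (g : ℂ[X]) : Prop where
  ne_zero : g ≠ 0
  support : g.support ⊆ blocks a b
  dvd : (X - 1) ^ (k + r) ∣ g

/-- Order `k + r` at 1 requires at least `k + r + 1` terms, which is the total size of the blocks.
-/
lemma IsBlockGenerator.support_eq (h : Interlaced a b k) {g : ℂ[X]}
    (hg : IsBlockGenerator a b k g) : g.support = blocks a b := by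
  refine Finset.eq_of_subset_of_card_le hg.support ?_
  rw [h.card_blocks]
  exact lt_card_support_of_X_sub_one_pow_dvd _ g hg.ne_zero hg.dvd

lemma IsBlockGenerator.coeff_ne_zero (h : Interlaced a b k) {g : ℂ[X]}
    (hg : IsBlockGenerator a b k g) {i : Fin (r + 1)} {n : ℕ} (h1 : a i ≤ n) (h2 : n ≤ b i) :
    g.coeff n ≠ 0 := by
  rw [← mem_support_iff, hg.support_eq h, mem_blocks]
  exact ⟨i, h1, h2⟩

/-- Vanishing to order `k + r` at 1 imposes `k + r` linear conditions on `k + r + 1` coefficients.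
-/
lemma Interlaced.exists_isBlockGenerator (h : Interlaced a b k) :
    ∃ g, IsBlockGenerator a b k g := by
  obtain ⟨x, hx, hx'⟩ := exists_ne_zero_of_card_lt
    (fun j : Fin (k + r) => lcoeff ℂ j ∘ₗ taylor 1 ∘ₗ ofCoeffs (blocks a b)) (by simp [h.card_blocks])
  refine ⟨ofCoeffs _ x, ?_, ?_, ?_⟩
  · exact fun h0 => hx (ofCoeffs_injective _ (h0.trans (map_zero _).symm))
  · exact support_ofCoeffs_subset _ x
  · rw [← C_1, X_sub_C_pow_dvd_iff, ← taylor_apply, X_pow_dvd_iff]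
    exact fun d hd => hx' ⟨d, hd⟩

lemma IsBlockGenerator.exists_smul_eq (h : Interlaced a b k) {f g : ℂ[X]}
    (hf : IsBlockGenerator a b k f) (hg : IsBlockGenerator a b k g) : ∃ c : ℂ, g = c • f := by
  have ha : f.coeff (a 0) ≠ 0 := hf.coeff_ne_zero h le_rfl (h.le 0)
  refine ⟨g.coeff (a 0) / f.coeff (a 0), ?_⟩
  by_contra hne
  -- A non-zero difference would be a generator whose coefficient at `a 0` vanishes, whereas
  -- generators have full support.
  have hdiff : IsBlockGenerator a b k (g - (g.coeff (a 0) / f.coeff (a 0)) • f) := by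
    refine ⟨sub_ne_zero.mpr hne, fun n hn => ?_, dvd_sub hg.dvd (dvd_smul_of_dvd _ hf.dvd)⟩
    by_contra hn'
    have h1 : f.coeff n = 0 := notMem_support_iff.mp fun h => hn' (hf.support h)
    have h2 : g.coeff n = 0 := notMem_support_iff.mp fun h => hn' (hg.support h)
    rw [mem_support_iff, coeff_sub, coeff_smul, h1, h2] at hn
    simp at hn
  refine hdiff.coeff_ne_zero h (i := 0) le_rfl (h.le 0) ?_
  rw [coeff_sub, coeff_smul, smul_eq_mul, div_mul_cancel₀ _ ha, sub_self]

/-- The space spanned by the parts of `g` supported on the blocks. -/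
def blockSpace (a b : Fin (r + 1) → ℕ) (g : ℂ[X]) : Submodule ℂ ℂ[X] :=
  Submodule.span ℂ (Set.range fun i => cut (Finset.Icc (a i) (b i)) g)

lemma IsBlockGenerator.rootMultiplicity_cut (h : Interlaced a b k) {g : ℂ[X]}
    (hg : IsBlockGenerator a b k g) (i : Fin (r + 1)) :
    rootMultiplicity 0 (cut (Finset.Icc (a i) (b i)) g) = a i := by
  refine rootMultiplicity_zero_eq ?_ fun t ht => ?_
  · rw [coeff_cut, if_pos (Finset.mem_Icc.mpr ⟨le_rfl, h.le i⟩)]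
    exact hg.coeff_ne_zero h le_rfl (h.le i)
  · rw [coeff_cut, if_neg]
    rw [Finset.mem_Icc]
    omega

lemma IsBlockGenerator.natDegree_cut (h : Interlaced a b k) {g : ℂ[X]}
    (hg : IsBlockGenerator a b k g) (i : Fin (r + 1)) :
    (cut (Finset.Icc (a i) (b i)) g).natDegree = b i := by
  refine natDegree_eq_of_le_of_coeff_ne_zero ?_ ?_
  · rw [natDegree_le_iff_coeff_eq_zero]
    intro t ht
    rw [coeff_cut, if_neg]
    rw [Finset.mem_Icc]
    omega
  · rw [coeff_cut, if_pos (Finset.mem_Icc.mpr ⟨h.le i, le_rfl⟩)]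
    exact hg.coeff_ne_zero h (h.le i) le_rfl

lemma IsBlockGenerator.cut_ne_zero (h : Interlaced a b k) {g : ℂ[X]}
    (hg : IsBlockGenerator a b k g) (i : Fin (r + 1)) : cut (Finset.Icc (a i) (b i)) g ≠ 0 := by
  intro h0
  have := coeff_cut (Finset.Icc (a i) (b i)) g (a i)
  rw [h0, if_pos (Finset.mem_Icc.mpr ⟨le_rfl, h.le i⟩), coeff_zero] at this
  exact hg.coeff_ne_zero h le_rfl (h.le i) this.symm

lemma IsBlockGenerator.linearIndependent_cut (h : Interlaced a b k) {g : ℂ[X]}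
    (hg : IsBlockGenerator a b k g) :
    LinearIndependent ℂ fun i => cut (Finset.Icc (a i) (b i)) g :=
  isLeadingIndex_natDegree.linearIndependent _ (hg.cut_ne_zero h) fun i j hij =>
    h.strictMono_right.injective (by simpa only [hg.natDegree_cut h] using hij)

instance (a b : Fin (r + 1) → ℕ) (g : ℂ[X]) : FiniteDimensional ℂ (blockSpace a b g) :=
  FiniteDimensional.span_of_finite ℂ (Set.finite_range _)

lemma IsBlockGenerator.finrank_blockSpace (h : Interlaced a b k) {g : ℂ[X]}
    (hg : IsBlockGenerator a b k g) : Module.finrank ℂ (blockSpace a b g) = r + 1 := by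
  rw [blockSpace, finrank_span_eq_card (hg.linearIndependent_cut h), Fintype.card_fin]

lemma sum_cut_blocks (h : Interlaced a b k) {g : ℂ[X]} (hg : g.support ⊆ blocks a b) :
    ∑ i, cut (Finset.Icc (a i) (b i)) g = g := by
  ext n
  rw [finsetSum_coeff]
  simp only [coeff_cut, Finset.mem_Icc]
  by_cases hn : n ∈ blocks a b
  · obtain ⟨i, hi⟩ := mem_blocks.mp hn
    rw [Finset.sum_eq_single i, if_pos hi]
    · exact fun j _ hj => if_neg fun h' => hj (h.eq_of_mem h'.1 h'.2 hi.1 hi.2)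
    · simp
  · rw [notMem_support_iff.mp fun h' => hn (hg h')]
    simp

lemma IsBlockGenerator.mem_blockSpace (h : Interlaced a b k) {g : ℂ[X]}
    (hg : IsBlockGenerator a b k g) : g ∈ blockSpace a b g := by
  have := Submodule.sum_mem (blockSpace a b g) (t := Finset.univ)
    (f := fun i => cut (Finset.Icc (a i) (b i)) g) fun i _ => Submodule.subset_span ⟨i, rfl⟩
  rwa [sum_cut_blocks h hg.support] at this

lemma finset_coe_image_eq (a : Fin (r + 1) → ℕ) (s : Set ℕ) (hs : s = Set.range a) :
    (Nat.cast : ℕ → ℤ) '' s = Set.range fun i => (a i : ℤ) := by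
  rw [hs, ← Set.range_comp]
  rfl

/-- Existence: the blocks of a generator span a space with the prescribed exponents. -/
theorem IsBlockGenerator.isTwoPointSpace (h : Interlaced a b k) {g : ℂ[X]}
    (hg : IsBlockGenerator a b k g) :
    IsTwoPointSpace r (Set.range fun i => (a i : ℤ))
      ((Nat.cast : ℕ → ℤ) '' ↑(insert (k + r) (Finset.range r))) (Set.range fun i => (b i : ℤ))
      (blockSpace a b g) := by
  have hfin := hg.finrank_blockSpace h
  have hmem : ∀ i, cut (Finset.Icc (a i) (b i)) g ∈ blockSpace a b g := fun i =>
    Submodule.subset_span ⟨i, rfl⟩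
  have h0 : indexSet (rootMultiplicity 0) (blockSpace a b g) = ↑(Finset.univ.image a) := by
    refine (isLeadingIndex_rootMultiplicity 0).indexSet_eq _ _ ?_ ?_
    · intro n hn
      obtain ⟨i, -, rfl⟩ := Finset.mem_image.mp hn
      exact ⟨_, hmem i, hg.cut_ne_zero h i, hg.rootMultiplicity_cut h i⟩
    · simp [hfin, Finset.card_image_of_injective _ h.strictMono_left.injective]
  have hi : indexSet natDegree (blockSpace a b g) = ↑(Finset.univ.image b) := by
    refine isLeadingIndex_natDegree.indexSet_eq _ _ ?_ ?_
    · intro n hn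
      obtain ⟨i, -, rfl⟩ := Finset.mem_image.mp hn
      exact ⟨_, hmem i, hg.cut_ne_zero h i, hg.natDegree_cut h i⟩
    · simp [hfin, Finset.card_image_of_injective _ h.strictMono_right.injective]
  -- At 1 only the exponent `k + r` is exhibited. Fuchs' relation bounds the sum of the other `r`
  -- exponents by `0 + 1 + ⋯ + (r - 1)`, which forces them to be `0, …, r - 1`.
  obtain ⟨E₁, h1, c1⟩ := (isLeadingIndex_rootMultiplicity 1).exists_finset (blockSpace a b g)
  rw [hfin] at c1
  obtain ⟨hF, hF'⟩ := sum_exponents_le _ hfin _ E₁ _ h0.symm h1 hi.symm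
    (by simp [Finset.card_image_of_injective _ h.strictMono_left.injective]) c1
    (by simp [Finset.card_image_of_injective _ h.strictMono_right.injective])
  rw [Finset.sum_image (fun x _ y _ h' => h.strictMono_left.injective h'),
    Finset.sum_image (fun x _ y _ h' => h.strictMono_right.injective h'), h.sum,
    Finset.sum_range_succ] at hF hF'
  have hord : rootMultiplicity 1 g = k + r := by
    refine le_antisymm ?_ ?_
    · have := lt_card_support_of_X_sub_one_pow_dvd (rootMultiplicity 1 g) g hg.ne_zero
        (by rw [← C_1]; exact pow_rootMultiplicity_dvd g 1)
      rw [hg.support_eq h, h.card_blocks] at this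
      omega
    · rw [le_rootMultiplicity_iff hg.ne_zero, C_1]
      exact hg.dvd
  have hgE : k + r ∈ E₁ := by
    rw [← Finset.mem_coe, h1]
    exact ⟨g, hg.mem_blockSpace h, hg.ne_zero, hord⟩
  obtain ⟨hs1, hs2⟩ := sum_range_add_le (E₁.erase (k + r)) 0 fun _ _ => Nat.zero_le _
  rw [Finset.card_erase_of_mem hgE, c1] at hs1 hs2
  simp only [Nat.zero_add, Nat.add_sub_cancel, Nat.Ico_zero_eq_range] at hs1 hs2
  have hsum := Finset.add_sum_erase E₁ (fun x => x) hgE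
  have hE₁ : E₁ = insert (k + r) (Finset.range r) := by
    rw [← hs2 (by omega), Finset.insert_erase hgE]
  refine ⟨hfin, hF' (by omega), ?_, ?_, ?_⟩
  · rw [exponentsAt_eq]
    exact finset_coe_image_eq _ _ (by simpa using h0)
  · rw [exponentsAt_eq, ← h1, hE₁]
  · rw [exponentsAtInfinity_eq]
    exact finset_coe_image_eq _ _ (by simpa using hi)

/-- Uniqueness: a space with the prescribed exponents is spanned by the blocks of a generator. -/
theorem IsBlockGenerator.eq_blockSpace (h : Interlaced a b k) {g : ℂ[X]}
    (hg : IsBlockGenerator a b k g) {V : Submodule ℂ ℂ[X]} (hV : Module.finrank ℂ V = r + 1)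
    (h0 : indexSet (rootMultiplicity 0) V = Set.range a)
    (h1 : k + r ∈ indexSet (rootMultiplicity 1) V)
    (hi : indexSet natDegree V = Set.range b) : V = blockSpace a b g := by
  have : FiniteDimensional ℂ V := Module.finite_of_finrank_pos (by omega)
  -- Killing the coefficients at `a_j` for `j < i` and at `b_j` for `j > i` takes `r` conditions.
  -- The order at 0 is then some `a_j` with `j ≥ i` and the degree some `b_t` with `t ≤ i`, and
  -- interlacing leaves only `j = i`.
  have hex : ∀ i, ∃ f ∈ V, f ≠ 0 ∧ rootMultiplicity 0 f = a i ∧ f.natDegree ≤ b i := by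
    intro i
    obtain ⟨f, hf, hf0, hφ⟩ := exists_mem_of_card_lt V
      (fun j : {j // j ≠ i} => lcoeff ℂ (if j.1 < i then a j else b j)) (by simp [hV])
    obtain ⟨j, hj⟩ : rootMultiplicity 0 f ∈ Set.range a := h0 ▸ ⟨f, hf, hf0, rfl⟩
    obtain ⟨t, ht⟩ : f.natDegree ∈ Set.range b := hi ▸ ⟨f, hf, hf0, rfl⟩
    have hij : i ≤ j := by
      by_contra! hlt
      have := hφ ⟨j, hlt.ne⟩
      rw [if_pos hlt, lcoeff_apply, hj] at this
      exact coeff_rootMultiplicity_ne_zero hf0 this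
    have hti : t ≤ i := by
      by_contra! hlt
      have := hφ ⟨t, hlt.ne'⟩
      rw [if_neg hlt.le.not_gt, lcoeff_apply, ht, coeff_natDegree] at this
      exact hf0 (leadingCoeff_eq_zero.mp this)
    have hle : a j ≤ b t := by
      rw [hj, ht]
      by_contra! hlt
      exact coeff_rootMultiplicity_ne_zero hf0 (coeff_eq_zero_of_natDegree_lt hlt)
    have hji : j = i := by
      refine le_antisymm ?_ hij
      by_contra! hlt
      have := h.lt i j hlt
      have := h.strictMono_right.monotone hti
      omega
    exact ⟨f, hf, hf0, by rw [← hj, hji], ht ▸ h.strictMono_right.monotone hti⟩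
  choose f hfV hf0 hfa hfb using hex
  have hcoeff : ∀ i n, n ∉ Finset.Icc (a i) (b i) → (f i).coeff n = 0 := by
    intro i n hn
    rw [Finset.mem_Icc] at hn
    by_cases hn' : n < a i
    · exact coeff_eq_zero_of_lt_rootMultiplicity (by rwa [hfa])
    · exact coeff_eq_zero_of_natDegree_lt ((hfb i).trans_lt (by omega))
  have hli := (isLeadingIndex_rootMultiplicity 0).linearIndependent f hf0 fun i j hij =>
    h.strictMono_left.injective (by simpa only [hfa] using hij)
  have hspan := span_range_eq_of_linearIndependent hV hli hfV
  obtain ⟨u, huV, hu0, hu1⟩ := h1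
  rw [← hspan, Submodule.mem_span_range_iff_exists_fun] at huV
  obtain ⟨c, hc⟩ := huV
  -- The basis elements live on disjoint blocks, so the blocks of the element `u` of order `k + r`
  -- at 1 are multiples of them. Thus `V` contains the blocks of a generator.
  have hcut : ∀ i, cut (Finset.Icc (a i) (b i)) u = c i • f i := by
    intro i
    ext n
    rw [coeff_cut, ← hc, finsetSum_coeff]
    split_ifs with hn
    · rw [Finset.sum_eq_single i]
      · intro j _ hj
        rw [coeff_smul, hcoeff j, smul_zero]
        intro hn'
        rw [Finset.mem_Icc] at hn hn'
        exact hj (h.eq_of_mem hn'.1 hn'.2 hn.1 hn.2)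
      · simp
    · rw [coeff_smul, hcoeff i n hn, smul_zero]
  have hu : IsBlockGenerator a b k u := by
    refine ⟨hu0, fun n hn => ?_, ?_⟩
    · by_contra hn'
      refine mem_support_iff.mp hn ?_
      rw [← hc, finsetSum_coeff]
      refine Finset.sum_eq_zero fun i _ => ?_
      rw [coeff_smul, hcoeff i, smul_zero]
      exact fun h' => hn' (mem_blocks.mpr ⟨i, Finset.mem_Icc.mp h'⟩)
    · rw [← C_1, ← hu1]
      exact pow_rootMultiplicity_dvd u 1
  obtain ⟨d, hd⟩ := hu.exists_smul_eq h hg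
  refine (span_range_eq_of_linearIndependent hV (hg.linearIndependent_cut h) fun i => ?_).symm
  rw [hd, map_smul, hcut]
  exact V.smul_mem _ (V.smul_mem _ (hfV i))

/-- The operator `x d/dx - b_i` shortens the `i`-th block by one. -/
theorem map_theta_blockSpace (h : Interlaced a b (k + 1)) {i : Fin (r + 1)} (b' : Fin (r + 1) → ℕ)
    (hb' : ∀ j, b j = b' j + if j = i then 1 else 0) {g : ℂ[X]}
    (hg : IsBlockGenerator a b (k + 1) g) (hai : a i ≤ b' i) :
    IsBlockGenerator a b' k (theta (b i) g) ∧
      (blockSpace a b g).map (theta (b i)) = blockSpace a b' (theta (b i) g) := by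
  -- The two intervals differ at most in the exponent `b i`, whose coefficient is annihilated.
  have hcut : ∀ j, cut (Finset.Icc (a j) (b j)) (theta (b i) g) =
      cut (Finset.Icc (a j) (b' j)) (theta (b i) g) := by
    intro j
    ext n
    have hbj := hb' j
    simp only [coeff_cut, Finset.mem_Icc, coeff_theta]
    by_cases hn : n = b i
    · simp [hn]
    · congr 1
      split_ifs at hbj with hj
      · subst hj
        exact propext (by omega)
      · rw [hbj, add_zero]
  refine ⟨⟨fun h0 => ?_, fun n hn => ?_, X_sub_one_pow_dvd_theta _ ?_⟩, ?_⟩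
  · have h1 : (theta (b i) g).coeff (b' i) = 0 := by rw [h0, coeff_zero]
    have h2 := hb' i
    rw [if_pos rfl] at h2
    rw [coeff_theta, h2] at h1
    refine hg.coeff_ne_zero h hai (by omega) ((mul_eq_zero.mp h1).resolve_left ?_)
    simp
  · rw [mem_support_iff, coeff_theta] at hn
    obtain ⟨j, h1, h2⟩ := mem_blocks.mp (hg.support (mem_support_iff.mpr (right_ne_zero_of_mul hn)))
    refine mem_blocks.mpr ⟨j, h1, ?_⟩
    have hbj := hb' j
    split_ifs at hbj with hj
    · subst hj
      have : n ≠ b j := fun h' => left_ne_zero_of_mul hn (by rw [h', sub_self])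
      omega
    · omega
  · convert hg.dvd using 2
    omega
  · rw [blockSpace, Submodule.map_span, ← Set.range_comp, blockSpace]
    congr 2
    ext1 j
    rw [Function.comp_apply, theta_cut, hcut]

end Interlaced

/-! ### Coefficients of `p / (1 - x)^(k+1)` as values of a polynomial. -/

section Hilbert

/-- The polynomial is the binomial coefficient `z - j + k` over `k`, with roots `j - k, …, j - 1`.
-/
lemma eval_preHilbertPoly_eq_zero {k j : ℕ} {z : ℤ} (h1 : (j : ℤ) - k ≤ z) (h2 : z < j) :
    (preHilbertPoly ℂ k j).eval (z : ℂ) = 0 := by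
  obtain ⟨t, ht⟩ : ∃ t : ℕ, (t : ℤ) = j - 1 - z := ⟨(j - 1 - z).toNat, by omega⟩
  have htk : t < k := by omega
  have hz : (z : ℂ) - j + 1 = -(t : ℂ) := by
    have : (t : ℂ) = j - 1 - z := by exact_mod_cast congrArg (Int.cast : ℤ → ℂ) ht
    rw [this]
    ring
  rw [preHilbertPoly, eval_smul, eval_comp]
  simp only [eval_add, eval_sub, eval_X, eval_C, eval_one]
  rw [hz, ascPochhammer_eval_neg_coe_nat_of_lt htk, smul_zero]

lemma eval_hilbertPoly_succ (p : ℂ[X]) (k : ℕ) (z : ℂ) :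
    (hilbertPoly p (k + 1)).eval z = ∑ i ∈ p.support, p.coeff i * (preHilbertPoly ℂ k i).eval z := by
  rw [hilbertPoly_succ, eval_finsetSum]
  simp only [eval_smul, smul_eq_mul]

lemma natDegree_hilbertPoly_le (p : ℂ[X]) (k : ℕ) : (hilbertPoly p (k + 1)).natDegree ≤ k := by
  rw [hilbertPoly_succ]
  refine natDegree_sum_le_of_forall_le _ _ fun i _ => (natDegree_smul_le _ _).trans ?_
  rw [natDegree_preHilbertPoly]

lemma eval_hilbertPoly_neg_eq_zero {p : ℂ[X]} {k : ℕ} {z : ℤ} (hz : z < 0)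
    (h : ∀ j, p.coeff j ≠ 0 → (j : ℤ) - k ≤ z) : (hilbertPoly p (k + 1)).eval (z : ℂ) = 0 := by
  rw [eval_hilbertPoly_succ]
  refine Finset.sum_eq_zero fun j hj => ?_
  rw [eval_preHilbertPoly_eq_zero (h j (mem_support_iff.mp hj)) (by omega), mul_zero]

/-- The power series expansion of `p / (1 - x)^(k+1)` for `deg p ≤ k`. -/
lemma mk_eval_hilbertPoly {p : ℂ[X]} {k : ℕ} (hp : p.natDegree ≤ k) :
    PowerSeries.mk (fun n : ℕ => (hilbertPoly p (k + 1)).eval (n : ℂ)) =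
      p * PowerSeries.mk fun n : ℕ => ((k + n).choose k : ℂ) := by
  ext n
  rw [PowerSeries.coeff_mk, PowerSeries.coeff_mul, eval_hilbertPoly_succ,
    Finset.Nat.sum_antidiagonal_eq_sum_range_succ (fun i j =>
      PowerSeries.coeff i (p : PowerSeries ℂ) *
        PowerSeries.coeff j (PowerSeries.mk fun n : ℕ => ((k + n).choose k : ℂ)))]
  simp only [coeff_coe, PowerSeries.coeff_mk]
  -- For `n < i` the polynomial value must be zero. This uses `i ≤ k`, which places `n` among the
  -- roots `i - k, …, i - 1`.
  have hi : ∀ i, p.coeff i ≠ 0 → (preHilbertPoly ℂ k i).eval (n : ℂ) =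
      if i ≤ n then ((k + (n - i)).choose k : ℂ) else 0 := by
    intro i hi
    split_ifs with hin
    · rw [preHilbertPoly_eq_choose_sub_add ℂ k hin, add_comm]
    · have := le_natDegree_of_ne_zero hi
      exact_mod_cast eval_preHilbertPoly_eq_zero (z := (n : ℤ)) (k := k) (j := i)
        (by omega) (by omega)
  calc ∑ i ∈ p.support, p.coeff i * (preHilbertPoly ℂ k i).eval (n : ℂ)
      = ∑ i ∈ p.support, p.coeff i * if i ≤ n then ((k + (n - i)).choose k : ℂ) else 0 :=
        Finset.sum_congr rfl fun i h => by rw [hi i (mem_support_iff.mp h)]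
    _ = ∑ i ∈ p.support ∪ Finset.range (n + 1),
          p.coeff i * if i ≤ n then ((k + (n - i)).choose k : ℂ) else 0 := by
        refine Finset.sum_subset Finset.subset_union_left fun i _ h => ?_
        rw [notMem_support_iff.mp h, zero_mul]
    _ = ∑ i ∈ Finset.range (n + 1),
          p.coeff i * if i ≤ n then ((k + (n - i)).choose k : ℂ) else 0 := by
        refine (Finset.sum_subset Finset.subset_union_right fun i _ h => ?_).symm
        rw [if_neg (by simpa using h), mul_zero]
    _ = _ := Finset.sum_congr rfl fun i h => by
        rw [if_pos (Nat.lt_succ_iff.mp (Finset.mem_range.mp h))]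

lemma coe_eq_one_sub_X_pow_mul {p : ℂ[X]} {k : ℕ} (hp : p.natDegree ≤ k) :
    (p : PowerSeries ℂ) = (1 - PowerSeries.X) ^ (k + 1) *
      PowerSeries.mk (fun n : ℕ => (hilbertPoly p (k + 1)).eval (n : ℂ)) := by
  rw [mk_eval_hilbertPoly hp, mul_left_comm, mul_comm ((1 - PowerSeries.X) ^ (k + 1)),
    PowerSeries.mk_add_choose_mul_one_sub_pow_eq_one, mul_one]

lemma eval_hilbertPoly_of_dvd {H p : ℂ[X]} {k N : ℕ} (hp : p.natDegree ≤ k)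
    (h : X ^ N ∣ (X - 1) ^ (k + 1) * H - p) {n : ℕ} (hn : n < N) :
    (hilbertPoly p (k + 1)).eval (n : ℂ) = (-1) ^ (k + 1) * H.coeff n := by
  set c := PowerSeries.mk (fun n : ℕ => (hilbertPoly p (k + 1)).eval (n : ℂ)) with hc
  have h1 : (PowerSeries.X : PowerSeries ℂ) ^ N ∣
      (PowerSeries.X - 1) ^ (k + 1) * (H : PowerSeries ℂ) - (p : PowerSeries ℂ) := by
    obtain ⟨q, hq⟩ := h
    refine ⟨q, ?_⟩
    have := congrArg (fun f : ℂ[X] => (f : PowerSeries ℂ)) hq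
    simpa using this
  have hu := PowerSeries.mk_add_choose_mul_one_sub_pow_eq_one ℂ k
  have h2 : (PowerSeries.X : PowerSeries ℂ) ^ N ∣ (-1) ^ (k + 1) * (H : PowerSeries ℂ) - c := by
    have h3 := h1.mul_left (PowerSeries.mk fun n : ℕ => ((k + n).choose k : ℂ))
    have h4 : (PowerSeries.X - 1 : PowerSeries ℂ) ^ (k + 1) =
        (-1) ^ (k + 1) * (1 - PowerSeries.X) ^ (k + 1) := by
      rw [← mul_pow]
      congr 1
      ring
    rw [coe_eq_one_sub_X_pow_mul hp, h4] at h3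
    convert h3 using 1
    linear_combination (-((-1) ^ (k + 1) * (H : PowerSeries ℂ) - c)) * hu
  have h5 := PowerSeries.X_pow_dvd_iff.mp h2 n hn
  have h6 : ((-1) ^ (k + 1) * (H : PowerSeries ℂ)) = PowerSeries.C ((-1) ^ (k + 1)) * (H : PowerSeries ℂ) := by simp
  rw [map_sub, h6, PowerSeries.coeff_C_mul, hc, PowerSeries.coeff_mk, coeff_coe] at h5
  exact (sub_eq_zero.mp h5).symm

end Hilbert

/-! ### The spaces `V`: Padé pairs and their generators. -/

section Gapped

variable {r : ℕ}

/-- The pattern `0 = a_0 < b_1 ≤ a_1 < b_2 ≤ ⋯ < b_r ≤ a_r` with `∑ (a_i - b_i) = l ≤ k`. -/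
structure Gapped (a : Fin (r + 1) → ℕ) (b : Fin r → ℕ) (l k : ℕ) : Prop where
  zero : a 0 = 0
  lt : ∀ i : Fin r, a i.castSucc < b i
  le : ∀ i : Fin r, b i ≤ a i.succ
  l_le : l ≤ k
  sum : ∑ i : Fin r, a i.succ = ∑ i, b i + l

/-- The union of the half-open intervals `[a_{i-1}, b_i)`. -/
def openBlocks (a : Fin (r + 1) → ℕ) (b : Fin r → ℕ) : Finset ℕ :=
  Finset.univ.biUnion fun i : Fin r => Finset.Ico (a i.castSucc) (b i)

lemma mem_openBlocks {a : Fin (r + 1) → ℕ} {b : Fin r → ℕ} {n : ℕ} :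
    n ∈ openBlocks a b ↔ ∃ i : Fin r, a i.castSucc ≤ n ∧ n < b i := by
  simp [openBlocks]

variable {a : Fin (r + 1) → ℕ} {b : Fin r → ℕ} {l k : ℕ}

lemma Gapped.strictMono_left (h : Gapped a b l k) : StrictMono a :=
  Fin.strictMono_iff_lt_succ.mpr fun i => (h.lt i).trans_le (h.le i)

lemma Gapped.le_of_lt (h : Gapped a b l k) {i j : Fin r} (hij : i < j) : b i ≤ a j.castSucc :=
  (h.le i).trans (h.strictMono_left.monotone (by simpa [Fin.le_def] using hij))

lemma Gapped.strictMono_right (h : Gapped a b l k) : StrictMono b :=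
  fun _ j hij => (h.le_of_lt hij).trans_lt (h.lt j)

lemma Gapped.eq_of_mem (h : Gapped a b l k) {i j : Fin r} {n : ℕ} (h1 : a i.castSucc ≤ n)
    (h2 : n < b i) (h3 : a j.castSucc ≤ n) (h4 : n < b j) : i = j := by
  rcases lt_trichotomy i j with hij | hij | hij
  · have := h.le_of_lt hij
    omega
  · exact hij
  · have := h.le_of_lt hij
    omega

lemma Gapped.lt_last (h : Gapped a b l k) {i : Fin r} {n : ℕ} (hn : n < b i) :
    n < a (Fin.last r) :=
  hn.trans_le ((h.le i).trans (h.strictMono_left.monotone (Fin.le_last _)))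

lemma Gapped.sum_castSucc (h : Gapped a b l k) :
    ∑ i : Fin r, a i.castSucc + a (Fin.last r) = ∑ i, b i + l := by
  rw [← Fin.sum_univ_castSucc, Fin.sum_univ_succ, h.zero, h.sum, zero_add]

lemma Gapped.card_openBlocks (h : Gapped a b l k) :
    (openBlocks a b).card + l = a (Fin.last r) := by
  rw [openBlocks, Finset.card_biUnion]
  · have h1 : ∑ i : Fin r, ((Finset.Ico (a i.castSucc) (b i)).card + a i.castSucc) = ∑ i, b i :=
      Finset.sum_congr rfl fun i _ => by
        rw [Nat.card_Ico]
        have := h.lt i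
        omega
    rw [Finset.sum_add_distrib] at h1
    have := h.sum_castSucc
    omega
  · intro i _ j _ hij
    refine Finset.disjoint_left.mpr fun n hi hj => ?_
    rw [Finset.mem_Ico] at hi hj
    exact hij (h.eq_of_mem hi.1 hi.2 hj.1 hj.2)

/-- `p / (x - 1)^(k+1)` agrees with `H` up to order `a_r`, where `deg p ≤ l` and `H` is supported
on the half-open blocks. -/
structure IsPadePair (a : Fin (r + 1) → ℕ) (b : Fin r → ℕ) (l k : ℕ) (H p : ℂ[X]) : Prop where
  support : H.support ⊆ openBlocks a b
  natDegree_le : p.natDegree ≤ l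
  dvd : X ^ a (Fin.last r) ∣ (X - 1) ^ (k + 1) * H - p

lemma IsPadePair.sub_smul {H p H' p' : ℂ[X]} (h : IsPadePair a b l k H p)
    (h' : IsPadePair a b l k H' p') (c : ℂ) : IsPadePair a b l k (H - c • H') (p - c • p') := by
  refine ⟨fun n hn => ?_, ?_, ?_⟩
  · by_contra hn'
    have h1 : H.coeff n = 0 := notMem_support_iff.mp fun h0 => hn' (h.support h0)
    have h2 : H'.coeff n = 0 := notMem_support_iff.mp fun h0 => hn' (h'.support h0)
    rw [mem_support_iff, coeff_sub, coeff_smul, h1, h2] at hn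
    simp at hn
  · exact (natDegree_sub_le _ _).trans
      (max_le h.natDegree_le ((natDegree_smul_le _ _).trans h'.natDegree_le))
  · have : (X - 1) ^ (k + 1) * (H - c • H') - (p - c • p') =
        ((X - 1) ^ (k + 1) * H - p) - c • ((X - 1) ^ (k + 1) * H' - p') := by
      rw [smul_sub, mul_sub, mul_smul_comm]
      ring
    rw [this]
    exact dvd_sub h.dvd (dvd_smul_of_dvd _ h'.dvd)

/-- The zeros of the polynomial interpolating the coefficients of a Padé pair. -/
def padeZeros (a : Fin (r + 1) → ℕ) (b : Fin r → ℕ) (l k : ℕ) : Finset ℤ :=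
  (Finset.range (a (Fin.last r)) \ openBlocks a b).map Nat.castEmbedding ∪
    Finset.Ico ((l : ℤ) - k) 0

/-- There are `l` gaps below `a_r` and `k - l` negative integers. -/
lemma Gapped.card_padeZeros (h : Gapped a b l k) : (padeZeros a b l k).card = k := by
  rw [padeZeros, Finset.card_union_of_disjoint, Finset.card_map, Finset.card_sdiff_of_subset,
    Finset.card_range, Int.card_Ico]
  · have := h.card_openBlocks
    have := h.l_le
    omega
  · intro n hn
    obtain ⟨i, -, hi⟩ := mem_openBlocks.mp hn
    exact Finset.mem_range.mpr (h.lt_last hi)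
  · refine Finset.disjoint_left.mpr fun z hz hz' => ?_
    obtain ⟨n, -, rfl⟩ := Finset.mem_map.mp hz
    rw [Finset.mem_Ico, Nat.castEmbedding_apply] at hz'
    omega

/-- The Hilbert polynomial of `p` has degree at most `k`. It vanishes on the gaps because `H` has no
coefficients there, and on `[l - k, 0)` because `deg p ≤ l`. With the extra zero `z` it has `k + 1`
zeros. -/
lemma IsPadePair.eq_zero (h : Gapped a b l k) {H p : ℂ[X]} (hp : IsPadePair a b l k H p)
    {z : ℤ} (hz : z ∉ padeZeros a b l k) (h0 : (hilbertPoly p (k + 1)).eval (z : ℂ) = 0) :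
    H = 0 ∧ p = 0 := by
  have hpk := hp.natDegree_le.trans h.l_le
  have hc : hilbertPoly p (k + 1) = 0 := by
    refine eq_zero_of_natDegree_lt_card_of_eval_eq_zero' _
      ((insert z (padeZeros a b l k)).map ⟨(Int.cast : ℤ → ℂ), Int.cast_injective⟩) ?_ ?_
    · intro w hw
      obtain ⟨y, hy, rfl⟩ := Finset.mem_map.mp hw
      rw [Function.Embedding.coeFn_mk]
      rcases Finset.mem_insert.mp hy with rfl | hy
      · exact h0
      · rcases Finset.mem_union.mp hy with hy | hy
        · obtain ⟨n, hn, rfl⟩ := Finset.mem_map.mp hy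
          rw [Finset.mem_sdiff, Finset.mem_range] at hn
          rw [Nat.castEmbedding_apply, Int.cast_natCast, eval_hilbertPoly_of_dvd hpk hp.dvd hn.1,
            notMem_support_iff.mp fun h' => hn.2 (hp.support h'), mul_zero]
        · rw [Finset.mem_Ico] at hy
          refine eval_hilbertPoly_neg_eq_zero hy.2 fun j hj => ?_
          have := (le_natDegree_of_ne_zero hj).trans hp.natDegree_le
          omega
    · rw [Finset.card_map, Finset.card_insert_of_notMem hz, h.card_padeZeros]
      exact Nat.lt_succ_of_le (natDegree_hilbertPoly_le p k)
  refine ⟨?_, ?_⟩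
  · ext n
    rw [coeff_zero]
    by_contra hn
    obtain ⟨i, -, hi⟩ := mem_openBlocks.mp (hp.support (mem_support_iff.mpr hn))
    have := eval_hilbertPoly_of_dvd hpk hp.dvd (h.lt_last hi)
    rw [hc, eval_zero] at this
    exact mul_ne_zero (pow_ne_zero _ (neg_ne_zero.mpr one_ne_zero)) hn this.symm
  · have := coe_eq_one_sub_X_pow_mul hpk
    rw [hc] at this
    simp only [eval_zero] at this
    have h1 : (PowerSeries.mk fun _ : ℕ => (0 : ℂ)) = 0 := by
      ext
      simp
    rw [h1, mul_zero] at this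
    exact_mod_cast this

lemma IsPadePair.eq_zero_of_coeff_eq_zero (h : Gapped a b l k) {H p : ℂ[X]}
    (hp : IsPadePair a b l k H p) {n : ℕ} (hn : n ∈ openBlocks a b) (h0 : H.coeff n = 0) :
    H = 0 ∧ p = 0 := by
  obtain ⟨i, -, hi⟩ := mem_openBlocks.mp hn
  refine hp.eq_zero h (z := (n : ℤ)) ?_ ?_
  · rw [padeZeros, Finset.mem_union, Finset.mem_map, Finset.mem_Ico]
    rintro (⟨t, ht, hnt⟩ | hn')
    · rw [Nat.castEmbedding_apply, Nat.cast_inj] at hnt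
      exact (Finset.mem_sdiff.mp ht).2 (hnt ▸ hn)
    · omega
  · rw [Int.cast_natCast, eval_hilbertPoly_of_dvd (hp.natDegree_le.trans h.l_le) hp.dvd
      (h.lt_last hi), h0, mul_zero]

/-- If the degree of `p` drops below `l`, the range of negative zeros extends by one, to `l - k -
1`. -/
lemma IsPadePair.eq_zero_of_coeff_eq_zero' (h : Gapped a b l k) {H p : ℂ[X]}
    (hp : IsPadePair a b l k H p) (h0 : p.coeff l = 0) : H = 0 ∧ p = 0 := by
  have := h.l_le
  refine hp.eq_zero h (z := (l : ℤ) - k - 1) ?_ ?_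
  · rw [padeZeros, Finset.mem_union, Finset.mem_map, Finset.mem_Ico]
    rintro (⟨t, ht, hnt⟩ | hn')
    · rw [Nat.castEmbedding_apply] at hnt
      omega
    · omega
  · refine eval_hilbertPoly_neg_eq_zero (by omega) fun j hj => ?_
    have h1 := (le_natDegree_of_ne_zero hj).trans hp.natDegree_le
    have h2 : j ≠ l := fun h' => hj (h' ▸ h0)
    omega

/-- A non-zero Padé pair. -/
structure IsPadeGenerator (a : Fin (r + 1) → ℕ) (b : Fin r → ℕ) (l k : ℕ) (H p : ℂ[X]) : Prop
    extends IsPadePair a b l k H p where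
  coeff_ne_zero : ∀ n ∈ openBlocks a b, H.coeff n ≠ 0
  natDegree_eq : p.natDegree = l
  ne_zero : p ≠ 0

lemma IsPadePair.isPadeGenerator (h : Gapped a b l k) {H p : ℂ[X]}
    (hp : IsPadePair a b l k H p) (h0 : ¬(H = 0 ∧ p = 0)) : IsPadeGenerator a b l k H p := by
  have hl : p.coeff l ≠ 0 := fun h' => h0 (hp.eq_zero_of_coeff_eq_zero' h h')
  exact ⟨hp, fun n hn h' => h0 (hp.eq_zero_of_coeff_eq_zero h hn h'),
    natDegree_eq_of_le_of_coeff_ne_zero hp.natDegree_le hl, fun h' => hl (by simp [h'])⟩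

/-- The coefficients of `H` and `p` are `(a_r - l) + (l + 1)` unknowns, subject to `a_r` conditions.
-/
lemma Gapped.exists_isPadeGenerator (h : Gapped a b l k) :
    ∃ H p, IsPadeGenerator a b l k H p := by
  let F : (openBlocks a b → ℂ) × (Finset.range (l + 1) → ℂ) →ₗ[ℂ] ℂ[X] :=
    LinearMap.mulLeft ℂ ((X - 1) ^ (k + 1)) ∘ₗ ofCoeffs _ ∘ₗ LinearMap.fst ℂ _ _ -
      ofCoeffs _ ∘ₗ LinearMap.snd ℂ _ _
  obtain ⟨x, hx, hx'⟩ := exists_ne_zero_of_card_lt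
    (fun j : Fin (a (Fin.last r)) => lcoeff ℂ j ∘ₗ F) (by
      have := h.card_openBlocks
      simp only [Module.finrank_prod, Module.finrank_fintype_fun_eq_card, Fintype.card_fin,
        Fintype.card_coe, Finset.card_range]
      omega)
  refine ⟨ofCoeffs _ x.1, ofCoeffs _ x.2, IsPadePair.isPadeGenerator h ⟨?_, ?_, ?_⟩ ?_⟩
  · exact support_ofCoeffs_subset _ _
  · rw [natDegree_le_iff_coeff_eq_zero]
    intro N hN
    rw [coeff_ofCoeffs, dif_neg (by simpa using hN)]
  · rw [X_pow_dvd_iff]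
    exact fun d hd => hx' ⟨d, hd⟩
  · rintro ⟨h1, h2⟩
    exact hx (Prod.ext (ofCoeffs_injective _ (h1.trans (map_zero _).symm))
      (ofCoeffs_injective _ (h2.trans (map_zero _).symm)))

lemma IsPadeGenerator.exists_smul_eq (h : Gapped a b l k) {H p H' p' : ℂ[X]}
    (hp : IsPadeGenerator a b l k H p) (hp' : IsPadeGenerator a b l k H' p') :
    ∃ c : ℂ, H' = c • H ∧ p' = c • p := by
  have hl : p.coeff l ≠ 0 := by
    rw [← hp.natDegree_eq]
    exact leadingCoeff_ne_zero.mpr hp.ne_zero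
  refine ⟨p'.coeff l / p.coeff l, ?_⟩
  obtain ⟨h1, h2⟩ := (hp'.sub_smul hp.toIsPadePair
    (p'.coeff l / p.coeff l)).eq_zero_of_coeff_eq_zero' h (by
      rw [coeff_sub, coeff_smul, smul_eq_mul, div_mul_cancel₀ _ hl, sub_self])
  exact ⟨sub_eq_zero.mp h1, sub_eq_zero.mp h2⟩

/-- The generators `p, (x-1)^(k+1) H_1, …, (x-1)^(k+1) H_r`, where the `H_i` are the parts of `H`
supported on the blocks. -/
def padeFamily (a : Fin (r + 1) → ℕ) (b : Fin r → ℕ) (k : ℕ) (H p : ℂ[X]) : Fin (r + 1) → ℂ[X] :=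
  Fin.cons p fun i => (X - 1) ^ (k + 1) * cut (Finset.Ico (a i.castSucc) (b i)) H

/-- The space spanned by `padeFamily`. -/
def padeSpace (a : Fin (r + 1) → ℕ) (b : Fin r → ℕ) (k : ℕ) (H p : ℂ[X]) : Submodule ℂ ℂ[X] :=
  Submodule.span ℂ (Set.range (padeFamily a b k H p))

/-- The exponents at infinity `l, b_1 + k, …, b_r + k`. -/
def padeDegrees (b : Fin r → ℕ) (l k : ℕ) : Fin (r + 1) → ℕ := Fin.cons l fun i => b i + k

lemma X_sub_one_pow_ne_zero (k : ℕ) : (X - 1 : ℂ[X]) ^ k ≠ 0 :=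
  pow_ne_zero _ (by simpa using X_sub_C_ne_zero (1 : ℂ))

lemma natDegree_X_sub_one_pow_mul (k : ℕ) {f : ℂ[X]} (hf : f ≠ 0) :
    ((X - 1) ^ k * f).natDegree = k + f.natDegree := by
  rw [natDegree_mul (X_sub_one_pow_ne_zero k) hf, natDegree_pow, ← C_1, natDegree_X_sub_C, mul_one]

lemma rootMultiplicity_X_sub_one_pow_mul (k : ℕ) {f : ℂ[X]} (hf : f ≠ 0) :
    rootMultiplicity 0 ((X - 1) ^ k * f) = rootMultiplicity 0 f := by
  rw [rootMultiplicity_mul (mul_ne_zero (X_sub_one_pow_ne_zero k) hf),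
    rootMultiplicity_eq_zero (p := (X - 1) ^ k), zero_add]
  simp

lemma Gapped.injective_padeDegrees (h : Gapped a b l k) :
    Function.Injective (padeDegrees b l k) := by
  rw [padeDegrees, Fin.cons_injective_iff]
  refine ⟨?_, fun i j hij => h.strictMono_right.injective (by simpa using hij)⟩
  rintro ⟨i, hi⟩
  have := h.lt i
  have := h.l_le
  simp only at hi
  omega

lemma IsPadeGenerator.coeff_cut_ne_zero {H p : ℂ[X]}
    (hp : IsPadeGenerator a b l k H p) (i : Fin r) {n : ℕ} (h1 : a i.castSucc ≤ n)
    (h2 : n < b i) : (cut (Finset.Ico (a i.castSucc) (b i)) H).coeff n ≠ 0 := by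
  rw [coeff_cut, if_pos (Finset.mem_Ico.mpr ⟨h1, h2⟩)]
  exact hp.coeff_ne_zero n (mem_openBlocks.mpr ⟨i, h1, h2⟩)

lemma IsPadeGenerator.cut_ne_zero (h : Gapped a b l k) {H p : ℂ[X]}
    (hp : IsPadeGenerator a b l k H p) (i : Fin r) :
    cut (Finset.Ico (a i.castSucc) (b i)) H ≠ 0 := fun h0 =>
  hp.coeff_cut_ne_zero i le_rfl (h.lt i) (by rw [h0, coeff_zero])

lemma IsPadeGenerator.rootMultiplicity_cut (h : Gapped a b l k) {H p : ℂ[X]}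
    (hp : IsPadeGenerator a b l k H p) (i : Fin r) :
    rootMultiplicity 0 (cut (Finset.Ico (a i.castSucc) (b i)) H) = a i.castSucc := by
  refine rootMultiplicity_zero_eq (hp.coeff_cut_ne_zero i le_rfl (h.lt i)) fun t ht => ?_
  rw [coeff_cut, if_neg]
  rw [Finset.mem_Ico]
  omega

lemma IsPadeGenerator.natDegree_cut (h : Gapped a b l k) {H p : ℂ[X]}
    (hp : IsPadeGenerator a b l k H p) (i : Fin r) :
    (cut (Finset.Ico (a i.castSucc) (b i)) H).natDegree = b i - 1 := by
  have := h.lt i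
  refine natDegree_eq_of_le_of_coeff_ne_zero ?_
    (hp.coeff_cut_ne_zero i (by omega) (by omega))
  rw [natDegree_le_iff_coeff_eq_zero]
  intro t ht
  rw [coeff_cut, if_neg]
  rw [Finset.mem_Ico]
  omega

lemma IsPadeGenerator.padeFamily_ne_zero (h : Gapped a b l k) {H p : ℂ[X]}
    (hp : IsPadeGenerator a b l k H p) (i : Fin (r + 1)) : padeFamily a b k H p i ≠ 0 := by
  refine Fin.cases hp.ne_zero (fun i => ?_) i
  exact mul_ne_zero (X_sub_one_pow_ne_zero _) (hp.cut_ne_zero h i)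

lemma IsPadeGenerator.natDegree_padeFamily (h : Gapped a b l k) {H p : ℂ[X]}
    (hp : IsPadeGenerator a b l k H p) (i : Fin (r + 1)) :
    (padeFamily a b k H p i).natDegree = padeDegrees b l k i := by
  refine Fin.cases hp.natDegree_eq (fun i => ?_) i
  change ((X - 1) ^ (k + 1) * cut (Finset.Ico (a i.castSucc) (b i)) H).natDegree = b i + k
  rw [natDegree_X_sub_one_pow_mul _ (hp.cut_ne_zero h i), hp.natDegree_cut h]
  have := h.lt i
  omega

lemma IsPadeGenerator.linearIndependent (h : Gapped a b l k) {H p : ℂ[X]}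
    (hp : IsPadeGenerator a b l k H p) : LinearIndependent ℂ (padeFamily a b k H p) :=
  isLeadingIndex_natDegree.linearIndependent _ (hp.padeFamily_ne_zero h) fun i j hij =>
    h.injective_padeDegrees (by simpa only [hp.natDegree_padeFamily h] using hij)

instance (a : Fin (r + 1) → ℕ) (b : Fin r → ℕ) (k : ℕ) (H p : ℂ[X]) :
    FiniteDimensional ℂ (padeSpace a b k H p) :=
  FiniteDimensional.span_of_finite ℂ (Set.finite_range _)

lemma IsPadeGenerator.finrank_padeSpace (h : Gapped a b l k) {H p : ℂ[X]}
    (hp : IsPadeGenerator a b l k H p) : Module.finrank ℂ (padeSpace a b k H p) = r + 1 := by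
  rw [padeSpace, finrank_span_eq_card (hp.linearIndependent h), Fintype.card_fin]

lemma sum_cut_openBlocks (h : Gapped a b l k) {H : ℂ[X]} (hH : H.support ⊆ openBlocks a b) :
    ∑ i : Fin r, cut (Finset.Ico (a i.castSucc) (b i)) H = H := by
  ext n
  rw [finsetSum_coeff]
  simp only [coeff_cut, Finset.mem_Ico]
  by_cases hn : n ∈ openBlocks a b
  · obtain ⟨i, hi⟩ := mem_openBlocks.mp hn
    rw [Finset.sum_eq_single i, if_pos hi]
    · exact fun j _ hj => if_neg fun h' => hj (h.eq_of_mem h'.1 h'.2 hi.1 hi.2)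
    · simp
  · rw [notMem_support_iff.mp fun h' => hn (hH h')]
    simp

end Gapped

/-! ### The space attached to a Padé generator, and the operator acting on it. -/

section PadeSpace

variable {r : ℕ} {a : Fin (r + 1) → ℕ} {b : Fin r → ℕ} {l k : ℕ}

lemma padeFamily_mem (a : Fin (r + 1) → ℕ) (b : Fin r → ℕ) (k : ℕ) (H p : ℂ[X])
    (i : Fin (r + 1)) : padeFamily a b k H p i ∈ padeSpace a b k H p :=
  Submodule.subset_span ⟨i, rfl⟩

lemma IsPadePair.mul_mem_padeSpace (h : Gapped a b l k) {H p : ℂ[X]}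
    (hp : IsPadePair a b l k H p) : (X - 1) ^ (k + 1) * H ∈ padeSpace a b k H p := by
  have := Submodule.sum_mem (padeSpace a b k H p) (t := Finset.univ)
    (f := fun i : Fin r => padeFamily a b k H p i.succ) fun i _ => padeFamily_mem a b k H p i.succ
  simp only [padeFamily, Fin.cons_succ] at this
  rwa [← Finset.mul_sum, sum_cut_openBlocks h hp.support] at this

lemma IsPadeGenerator.sub_ne_zero (h : Gapped a b l k) {H p : ℂ[X]}
    (hp : IsPadeGenerator a b l k H p) : p - (X - 1) ^ (k + 1) * H ≠ 0 := by
  intro h0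
  have hH : H ≠ 0 := by
    rintro rfl
    rw [mul_zero, sub_zero] at h0
    exact hp.ne_zero h0
  have h1 := congrArg natDegree (_root_.sub_eq_zero.mp h0)
  rw [natDegree_X_sub_one_pow_mul _ hH, hp.natDegree_eq] at h1
  have := h.l_le
  omega

/-- The exponents at `1` of the elements divisible by `(x - 1)^(k+1)`. -/
lemma IsPadeGenerator.exists_exponents_one (h : Gapped a b l k) {H p : ℂ[X]}
    (hp : IsPadeGenerator a b l k H p) :
    ∃ F : Finset ℕ, ↑F ⊆ indexSet (rootMultiplicity 1) (padeSpace a b k H p) ∧ F.card = r ∧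
      ∀ x ∈ F, k + 1 ≤ x := by
  let W := Submodule.span ℂ (Set.range (padeFamily a b k H p ∘ Fin.succ))
  have hW : W ≤ padeSpace a b k H p := by
    refine Submodule.span_le.mpr ?_
    rintro _ ⟨i, rfl⟩
    exact padeFamily_mem _ _ _ _ _ _
  have hWfin : FiniteDimensional ℂ W := FiniteDimensional.span_of_finite ℂ (Set.finite_range _)
  obtain ⟨F, hF, hFc⟩ := (isLeadingIndex_rootMultiplicity 1).exists_finset W
  rw [finrank_span_eq_card ((hp.linearIndependent h).comp _ (Fin.succ_injective r)),
    Fintype.card_fin] at hFc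
  refine ⟨F, hF ▸ indexSet_mono hW, hFc, fun x hx => ?_⟩
  rw [← Finset.mem_coe, hF] at hx
  obtain ⟨f, hfW, hf0, rfl⟩ := hx
  rw [le_rootMultiplicity_iff hf0, C_1]
  clear hf0
  induction hfW using Submodule.span_induction with
  | mem f hf =>
    obtain ⟨i, rfl⟩ := hf
    exact dvd_mul_right _ _
  | zero => exact dvd_zero _
  | add f g _ _ hf hg => exact dvd_add hf hg
  | smul c f _ hf => exact dvd_smul_of_dvd _ hf

/-- Existence: a Padé generator yields a space with the prescribed exponents. -/
theorem IsPadeGenerator.isTwoPointSpace (h : Gapped a b l k) {H p : ℂ[X]}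
    (hp : IsPadeGenerator a b l k H p) :
    IsTwoPointSpace r (Set.range fun i => (a i : ℤ))
      ((Nat.cast : ℕ → ℤ) '' ↑(insert 0 (Finset.Ico (k + 1) (k + 1 + r))))
      (Set.range fun i => (padeDegrees b l k i : ℤ)) (padeSpace a b k H p) := by
  have hfin := hp.finrank_padeSpace h
  have hi : indexSet natDegree (padeSpace a b k H p) = ↑(Finset.univ.image (padeDegrees b l k)) := by
    refine isLeadingIndex_natDegree.indexSet_eq _ _ ?_ ?_
    · intro n hn
      obtain ⟨i, -, rfl⟩ := Finset.mem_image.mp hn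
      exact ⟨_, padeFamily_mem _ _ _ _ _ _, hp.padeFamily_ne_zero h i, hp.natDegree_padeFamily h i⟩
    · simp [hfin, Finset.card_image_of_injective _ h.injective_padeDegrees]
  have hf0 := hp.sub_ne_zero h
  have hfmem : p - (X - 1) ^ (k + 1) * H ∈ padeSpace a b k H p :=
    Submodule.sub_mem _ (padeFamily_mem a b k H p 0) (hp.mul_mem_padeSpace h)
  -- Only `A ≥ a_r` is known directly, and at 1 only that `r` of the exponents are at least `k + 1`.
  -- Equality in Fuchs' relation then forces `A = a_r`, the remaining exponent `x = 0` at 1, and the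
  -- other exponents `k + 1, …, k + r`.
  set A := rootMultiplicity 0 (p - (X - 1) ^ (k + 1) * H) with hA
  have hle : a (Fin.last r) ≤ A := by
    rw [hA, le_rootMultiplicity_iff hf0, C_0, sub_zero, ← dvd_neg, neg_sub]
    exact hp.dvd
  have hAnot : A ∉ Finset.univ.image fun i : Fin r => a i.castSucc := by
    intro hmem
    obtain ⟨i, -, hiA⟩ := Finset.mem_image.mp hmem
    have := h.strictMono_left (Fin.castSucc_lt_last i)
    omega
  have hinj : Function.Injective fun i : Fin r => a i.castSucc :=
    h.strictMono_left.injective.comp (Fin.castSucc_injective r)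
  have hcard0 : (insert A (Finset.univ.image fun i : Fin r => a i.castSucc)).card = r + 1 := by
    rw [Finset.card_insert_of_notMem hAnot, Finset.card_image_of_injective _ hinj,
      Finset.card_univ, Fintype.card_fin]
  have h0 : indexSet (rootMultiplicity 0) (padeSpace a b k H p) =
      ↑(insert A (Finset.univ.image fun i : Fin r => a i.castSucc)) := by
    refine (isLeadingIndex_rootMultiplicity 0).indexSet_eq _ _ ?_ (by rw [hfin, hcard0])
    intro n hn
    rcases Finset.mem_insert.mp hn with rfl | hn
    · exact ⟨_, hfmem, hf0, rfl⟩
    · obtain ⟨i, -, rfl⟩ := Finset.mem_image.mp hn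
      refine ⟨_, padeFamily_mem a b k H p i.succ, hp.padeFamily_ne_zero h _, ?_⟩
      rw [padeFamily, Fin.cons_succ, rootMultiplicity_X_sub_one_pow_mul _ (hp.cut_ne_zero h i),
        hp.rootMultiplicity_cut h]
  obtain ⟨E₁, h1, c1⟩ :=
    (isLeadingIndex_rootMultiplicity 1).exists_finset (padeSpace a b k H p)
  rw [hfin] at c1
  obtain ⟨F, hF, hFc, hFk⟩ := hp.exists_exponents_one h
  rw [← h1, Finset.coe_subset] at hF
  obtain ⟨x, hx⟩ : ∃ x, E₁ \ F = {x} := by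
    rw [← Finset.card_eq_one, Finset.card_sdiff_of_subset hF, c1, hFc]
    omega
  have hsum := Finset.sum_sdiff (f := fun x : ℕ => x) hF
  rw [hx, Finset.sum_singleton] at hsum
  obtain ⟨hs1, hs2⟩ := sum_range_add_le F (k + 1) hFk
  rw [hFc, Finset.sum_add_distrib, Finset.sum_const, Finset.card_range, smul_eq_mul] at hs1 hs2
  have hcardi : (Finset.univ.image (padeDegrees b l k)).card = r + 1 := by
    simp [Finset.card_image_of_injective _ h.injective_padeDegrees]
  obtain ⟨hFu, hFu'⟩ := sum_exponents_le _ hfin _ E₁ _ h0.symm h1 hi.symm hcard0 c1 hcardi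
  rw [Finset.sum_insert hAnot, Finset.sum_image (fun x _ y _ h' => hinj h'),
    Finset.sum_image (fun x _ y _ h' => h.injective_padeDegrees h'), Finset.sum_range_succ,
    Fin.sum_univ_succ] at hFu hFu'
  simp only [padeDegrees, Fin.cons_zero, Fin.cons_succ, Finset.sum_add_distrib, Finset.sum_const,
    Finset.card_univ, Fintype.card_fin, smul_eq_mul] at hFu hFu'
  have hcs := h.sum_castSucc
  rw [Nat.mul_add, Nat.mul_one] at hs1 hs2
  have hAeq : A = a (Fin.last r) := by omega
  have hx0 : x = 0 := by omega
  have hE₁ : E₁ = insert 0 (Finset.Ico (k + 1) (k + 1 + r)) := by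
    rw [← hs2 (by omega), ← hx0, Finset.insert_eq, ← hx, Finset.sdiff_union_of_subset hF]
  refine ⟨hfin, hFu' (by omega), ?_, ?_, ?_⟩
  · rw [exponentsAt_eq]
    refine finset_coe_image_eq _ _ ?_
    rw [h0, hAeq]
    ext n
    simp only [Finset.coe_insert, Finset.coe_image, Finset.coe_univ, Set.image_univ,
      Set.mem_insert_iff, Set.mem_range]
    constructor
    · rintro (rfl | ⟨i, rfl⟩)
      · exact ⟨_, rfl⟩
      · exact ⟨_, rfl⟩
    · rintro ⟨i, rfl⟩
      refine Fin.lastCases (Or.inl rfl) (fun i => Or.inr ⟨i, rfl⟩) i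
  · rw [exponentsAt_eq, ← h1, hE₁]
  · rw [exponentsAtInfinity_eq]
    exact finset_coe_image_eq _ _ (by simpa using hi)

/-- Uniqueness: a space with the prescribed exponents is spanned by the family of a Padé
generator. -/
theorem IsPadeGenerator.eq_padeSpace (h : Gapped a b l k) {H p : ℂ[X]}
    (hp : IsPadeGenerator a b l k H p) {V : Submodule ℂ ℂ[X]} (hV : Module.finrank ℂ V = r + 1)
    (h0 : indexSet (rootMultiplicity 0) V = Set.range a)
    (h1 : indexSet (rootMultiplicity 1) V ⊆ {n | n ≠ 0 → k + 1 ≤ n})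
    (hi : indexSet natDegree V = Set.range (padeDegrees b l k)) : V = padeSpace a b k H p := by
  have : FiniteDimensional ℂ V := Module.finite_of_finrank_pos (by omega)
  have hl := h.l_le
  -- The `r` conditions are: no coefficient at the exponents at 0 preceding the `i`-th, none at the
  -- degrees `b_j + k` with `j > i`, and a zero at 1. The last forces order at least `k + 1` at 1,
  -- the exponents there being 0 or at least `k + 1`; this also excludes the degree `l ≤ k`.
  have hex : ∀ i : Fin r, ∃ q : ℂ[X], (X - 1) ^ (k + 1) * q ∈ V ∧ q ≠ 0 ∧
      ∀ n, q.coeff n ≠ 0 → a i.castSucc ≤ n ∧ n < b i := by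
    intro i
    obtain ⟨f, hf, hf0, hφ⟩ := exists_mem_of_card_lt V
      (fun j : Fin r => if j < i then lcoeff ℂ (a j.castSucc) else
        if j = i then lcoeff ℂ 0 ∘ₗ taylor 1 else lcoeff ℂ (b j + k)) (by simp [hV])
    have hroot : k + 1 ≤ rootMultiplicity 1 f := by
      refine h1 ⟨f, hf, hf0, rfl⟩ fun hz => ?_
      have := hφ i
      rw [if_neg (lt_irrefl i), if_pos rfl] at this
      refine (isLeadingIndex_rootMultiplicity 1).apply_ne_zero f hf0 ?_
      rw [hz]
      exact this
    rw [le_rootMultiplicity_iff hf0, C_1] at hroot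
    obtain ⟨q, rfl⟩ := hroot
    have hq : q ≠ 0 := right_ne_zero_of_mul hf0
    refine ⟨q, hf, hq, fun n hn => ⟨?_, ?_⟩⟩
    · by_contra! hlt
      obtain ⟨j, hj⟩ : rootMultiplicity 0 ((X - 1) ^ (k + 1) * q) ∈ Set.range a :=
        h0 ▸ ⟨_, hf, hf0, rfl⟩
      have hji : j < i.castSucc := by
        by_contra! hle
        refine hn (coeff_eq_zero_of_lt_rootMultiplicity ?_)
        rw [← rootMultiplicity_X_sub_one_pow_mul (k + 1) hq, ← hj]
        exact hlt.trans_le (h.strictMono_left.monotone hle)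
      obtain ⟨j, rfl⟩ := Fin.exists_castSucc_eq.mpr (hji.trans_le (Fin.le_last _)).ne
      have := hφ j
      rw [if_pos (by simpa using hji), lcoeff_apply, hj] at this
      exact coeff_rootMultiplicity_ne_zero hf0 this
    · obtain ⟨j, hj⟩ : ((X - 1) ^ (k + 1) * q).natDegree ∈ Set.range (padeDegrees b l k) :=
        hi ▸ ⟨_, hf, hf0, rfl⟩
      have hnq := le_natDegree_of_ne_zero hn
      have hdeg := natDegree_X_sub_one_pow_mul (k + 1) hq
      obtain rfl | ⟨j, rfl⟩ := Fin.eq_zero_or_eq_succ j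
      · rw [padeDegrees, Fin.cons_zero] at hj
        omega
      · rw [padeDegrees, Fin.cons_succ] at hj
        have hji : j ≤ i := by
          by_contra! hlt
          have := hφ j
          rw [if_neg hlt.le.not_gt, if_neg hlt.ne', lcoeff_apply, hj, coeff_natDegree] at this
          exact hf0 (leadingCoeff_eq_zero.mp this)
        have := h.strictMono_right.monotone hji
        omega
  choose q hqV hq0 hq using hex
  obtain ⟨u, huV, hu0, hu⟩ := exists_mem_of_card_lt V (fun j : Fin r => lcoeff ℂ (b j + k))
    (by simp [hV])
  have hul : u.natDegree = l := by
    obtain ⟨j, hj⟩ : u.natDegree ∈ Set.range (padeDegrees b l k) := hi ▸ ⟨_, huV, hu0, rfl⟩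
    obtain rfl | ⟨j, rfl⟩ := Fin.eq_zero_or_eq_succ j
    · exact hj.symm
    · rw [padeDegrees, Fin.cons_succ] at hj
      have := hu j
      rw [lcoeff_apply, hj, coeff_natDegree] at this
      exact absurd (leadingCoeff_eq_zero.mp this) hu0
  -- Killing the first `r` exponents at 0 leaves order `a_r`. Expanding this `f` in the basis formed
  -- by `u` and the `(x-1)^(k+1) q_i` produces a Padé pair.
  obtain ⟨f, hfV, hf0, hf⟩ := exists_mem_of_card_lt V
    (fun j : Fin r => lcoeff ℂ (a j.castSucc)) (by simp [hV])
  have hfX : X ^ a (Fin.last r) ∣ f := by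
    obtain ⟨j, hj⟩ : rootMultiplicity 0 f ∈ Set.range a := h0 ▸ ⟨_, hfV, hf0, rfl⟩
    obtain rfl | ⟨j, rfl⟩ := Fin.eq_castSucc_or_eq_last j |>.symm
    · have := pow_rootMultiplicity_dvd f 0
      rwa [← hj, C_0, sub_zero] at this
    · have := hf j
      rw [lcoeff_apply, hj] at this
      exact absurd this (coeff_rootMultiplicity_ne_zero hf0)
  have hqdeg : ∀ i, a i.castSucc ≤ (q i).natDegree ∧ (q i).natDegree < b i := fun i =>
    hq i _ (leadingCoeff_ne_zero.mpr (hq0 i))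
  have hli : LinearIndependent ℂ
      (Fin.cons u fun i => (X - 1) ^ (k + 1) * q i : Fin (r + 1) → ℂ[X]) := by
    refine isLeadingIndex_natDegree.linearIndependent _ (fun i => ?_) fun i j hij => ?_
    · exact Fin.cases hu0 (fun i => mul_ne_zero (X_sub_one_pow_ne_zero _) (hq0 i)) i
    · simp only at hij
      obtain rfl | ⟨i, rfl⟩ := Fin.eq_zero_or_eq_succ i <;>
        obtain rfl | ⟨j, rfl⟩ := Fin.eq_zero_or_eq_succ j
      · rfl
      · rw [Fin.cons_zero, Fin.cons_succ, natDegree_X_sub_one_pow_mul _ (hq0 j)] at hij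
        omega
      · rw [Fin.cons_zero, Fin.cons_succ, natDegree_X_sub_one_pow_mul _ (hq0 i)] at hij
        omega
      · rw [Fin.cons_succ, Fin.cons_succ, natDegree_X_sub_one_pow_mul _ (hq0 i),
          natDegree_X_sub_one_pow_mul _ (hq0 j)] at hij
        have hi' := hqdeg i
        have hj' := hqdeg j
        rw [h.eq_of_mem hi'.1 hi'.2 (j := j) (by omega) (by omega)]
  have hspan := span_range_eq_of_linearIndependent hV hli fun i =>
    Fin.cases huV (fun i => hqV i) i
  rw [← hspan, Submodule.mem_span_range_iff_exists_fun] at hfV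
  obtain ⟨c, hc⟩ := hfV
  rw [Fin.sum_univ_succ] at hc
  simp only [Fin.cons_zero, Fin.cons_succ] at hc
  set G := ∑ i : Fin r, c i.succ • q i with hG
  have hcG : (X - 1) ^ (k + 1) * G - -(c 0 • u) = f := by
    rw [← hc, hG, Finset.mul_sum, sub_neg_eq_add, add_comm]
    simp only [mul_smul_comm]
  have hGcoeff : ∀ n, G.coeff n ≠ 0 → n ∈ openBlocks a b := by
    intro n hn
    rw [hG, finsetSum_coeff] at hn
    obtain ⟨i, -, hi⟩ := Finset.exists_ne_zero_of_sum_ne_zero hn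
    rw [coeff_smul, smul_eq_mul] at hi
    exact mem_openBlocks.mpr ⟨i, hq i n (right_ne_zero_of_mul hi)⟩
  have hcut : ∀ i, cut (Finset.Ico (a i.castSucc) (b i)) G = c i.succ • q i := by
    intro i
    ext n
    rw [coeff_cut, hG, finsetSum_coeff]
    split_ifs with hn
    · rw [Finset.mem_Ico] at hn
      rw [Finset.sum_eq_single i]
      · intro j _ hj
        rw [coeff_smul, smul_eq_mul]
        by_contra hne
        have := hq j n (right_ne_zero_of_mul hne)
        exact hj (h.eq_of_mem this.1 this.2 hn.1 hn.2)
      · simp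
    · rw [coeff_smul, smul_eq_mul]
      by_contra hne
      exact hn (Finset.mem_Ico.mpr (hq i n (right_ne_zero_of_mul (Ne.symm hne))))
  have hgen : IsPadeGenerator a b l k G (-(c 0 • u)) := by
    refine IsPadePair.isPadeGenerator h ⟨fun n hn => hGcoeff n (mem_support_iff.mp hn), ?_, ?_⟩ ?_
    · rw [natDegree_neg]
      exact (natDegree_smul_le _ _).trans hul.le
    · rwa [hcG]
    · rintro ⟨h1, h2⟩
      rw [h1, h2, mul_zero, sub_zero] at hcG
      exact hf0 hcG.symm
  obtain ⟨d, rfl, rfl⟩ := hgen.exists_smul_eq h hp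
  refine (span_range_eq_of_linearIndependent hV (hp.linearIndependent h) fun i => ?_).symm
  refine Fin.cases ?_ (fun i => ?_) i
  · exact V.smul_mem _ (V.neg_mem (V.smul_mem _ huV))
  · rw [padeFamily, Fin.cons_succ, map_smul, hcut, mul_smul_comm, mul_smul_comm]
    exact V.smul_mem _ (V.smul_mem _ (hqV i))

/-- The operator `x (x - 1) d/dx - e (x - 1) - k - 1`. -/
def padeOp (e k : ℂ) : ℂ[X] →ₗ[ℂ] ℂ[X] :=
  LinearMap.mulLeft ℂ (X * (X - 1)) ∘ₗ derivative - e • LinearMap.mulLeft ℂ (X - 1) -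
    (k + 1) • LinearMap.id

lemma padeOp_apply (e k : ℂ) (f : ℂ[X]) :
    padeOp e k f = (X - 1) * theta e f - C (k + 1) * f := by
  simp only [padeOp, LinearMap.sub_apply, LinearMap.comp_apply, LinearMap.mulLeft_apply,
    LinearMap.smul_apply, LinearMap.id_apply, smul_eq_C_mul, theta_apply]
  ring

/-- Differentiating the power gives `(k+1) x (x-1)^(k+1) f`. Writing `x = (x - 1) + 1`, the constant
part cancels against `-(k+1)` and the rest shifts `e` by `k + 1`. -/
lemma padeOp_X_sub_one_pow_mul (e : ℂ) (k : ℕ) (f : ℂ[X]) :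
    padeOp e k ((X - 1) ^ (k + 1) * f) = (X - 1) ^ (k + 1 + 1) * theta (e - k - 1) f := by
  rw [padeOp_apply, theta_apply, theta_apply, derivative_mul, derivative_pow, derivative_sub,
    derivative_X, derivative_one]
  simp only [map_sub, map_add, map_one, map_natCast, Nat.add_sub_cancel]
  push_cast
  ring

lemma X_pow_dvd_padeOp {N : ℕ} {f : ℂ[X]} (e k : ℂ) (h : X ^ N ∣ f) : X ^ N ∣ padeOp e k f := by
  have h1 : X ^ N ∣ theta e f := by
    rw [X_pow_dvd_iff] at h ⊢
    intro d hd
    rw [coeff_theta, h d hd, mul_zero]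
  rw [padeOp_apply]
  exact dvd_sub (h1.mul_left _) (h.mul_left _)

/-- Multiples of `(x-1)^(k+1)` gain a factor `x - 1`, divisibility by `x^{a_r}` is preserved, and
the exponent `e - k - 1` disappears from the support of `H`. The two alternatives for `l'` cover
`D_i` with `i > 0` and with `i = 0`. -/
theorem map_padeOp_padeSpace (hr : 1 ≤ r) (h : Gapped a b l k) {b' : Fin r → ℕ} {l' : ℕ}
    (h' : Gapped a b' l' (k + 1)) (e : ℂ)
    (hb' : ∀ i n, a i.castSucc ≤ n → (n < b' i ↔ n < b i ∧ (n : ℂ) ≠ e - k - 1))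
    (hl' : l' = l + 1 ∨ l' = l ∧ e = l) {H p : ℂ[X]} (hp : IsPadeGenerator a b l k H p) :
    IsPadeGenerator a b' l' (k + 1) (theta (e - k - 1) H) (padeOp e k p) ∧
      (padeSpace a b k H p).map (padeOp e k) =
        padeSpace a b' (k + 1) (theta (e - k - 1) H) (padeOp e k p) := by
  refine ⟨IsPadePair.isPadeGenerator h' ⟨fun n hn => ?_, ?_, ?_⟩ ?_, ?_⟩
  · rw [mem_support_iff, coeff_theta] at hn
    obtain ⟨i, h1, h2⟩ :=
      mem_openBlocks.mp (hp.support (mem_support_iff.mpr (right_ne_zero_of_mul hn)))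
    exact mem_openBlocks.mpr
      ⟨i, h1, (hb' i n h1).mpr ⟨h2, _root_.sub_ne_zero.mp (left_ne_zero_of_mul hn)⟩⟩
  · rw [natDegree_le_iff_coeff_eq_zero]
    intro N hN
    have hcoeff : ∀ n, l < n → p.coeff n = 0 := fun n hn =>
      coeff_eq_zero_of_natDegree_lt (hp.natDegree_eq ▸ hn)
    obtain ⟨N, rfl⟩ : ∃ n, N = n + 1 := ⟨N - 1, by omega⟩
    rw [padeOp_apply, coeff_sub, coeff_C_mul, sub_mul, one_mul, coeff_sub, coeff_X_mul,
      coeff_theta, coeff_theta, hcoeff (N + 1) (by omega)]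
    -- The coefficient of the image at `x^{l+1}` is `(l - e)` times that of `p` at `x^l`; the degree
    -- bound therefore rises by one unless `e = l`.
    rcases hl' with rfl | ⟨rfl, rfl⟩
    · rw [hcoeff N (by omega)]
      ring
    · rcases (Nat.lt_succ_iff.mp hN).eq_or_lt with rfl | hlt
      · ring
      · rw [hcoeff N hlt]
        ring
  · rw [← padeOp_X_sub_one_pow_mul, ← map_sub]
    exact X_pow_dvd_padeOp _ _ hp.dvd
  -- The first interval stays non-empty after shortening, so its initial exponent `a_0` is not the
  -- one annihilated.
  · rintro ⟨h0, -⟩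
    have h1 := congrArg (fun f => f.coeff (a (Fin.castSucc ⟨0, hr⟩))) h0
    obtain ⟨h2, h3⟩ := (hb' ⟨0, hr⟩ _ le_rfl).mp (h'.lt ⟨0, hr⟩)
    simp only [coeff_theta, coeff_zero] at h1
    exact mul_ne_zero (_root_.sub_ne_zero.mpr h3)
      (hp.coeff_ne_zero _ (mem_openBlocks.mpr ⟨_, le_rfl, h2⟩)) h1
  · rw [padeSpace, Submodule.map_span, ← Set.range_comp, padeSpace]
    congr 2
    ext1 i
    refine Fin.cases rfl (fun i => ?_) i
    simp only [Function.comp_apply, padeFamily, Fin.cons_succ]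
    rw [padeOp_X_sub_one_pow_mul, theta_cut]
    congr 1
    ext n
    simp only [coeff_cut, Finset.mem_Ico, coeff_theta, and_congr_right (hb' i n)]
    by_cases hn : (n : ℂ) = e - k - 1
    · simp [hn]
    · simp [hn]

end PadeSpace

/-! ### Translation of consistent parameters into the two combinatorial patterns. -/

section Parameters

variable {r : ℕ}

/-- The exponent `i + n_1 + ⋯ + n_i`. -/
def expAt (n : Fin r → ℤ) (i : Fin (r + 1)) : ℤ := i.val + ∑ s : Fin r, if s.val < i.val then n s else 0

lemma expAt_zero (n : Fin r → ℤ) : expAt n 0 = 0 := by simp [expAt]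

lemma expAt_succ (n : Fin r → ℤ) (i : Fin r) : expAt n i.succ = expAt n i.castSucc + n i + 1 := by
  have h : ∀ s : Fin r, (if s.val < i.val + 1 then n s else 0) =
      (if s.val < i.val then n s else 0) + if s = i then n s else 0 := by
    intro s
    rcases lt_trichotomy s.val i.val with h | h | h
    · rw [if_pos (by omega), if_pos h, if_neg (by rw [Fin.ext_iff]; omega), add_zero]
    · rw [if_pos (by omega), if_neg (by omega), if_pos (Fin.ext h), zero_add]
    · rw [if_neg (by omega), if_neg (by omega), if_neg (by rw [Fin.ext_iff]; omega), add_zero]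
  simp only [expAt, Fin.val_succ, Fin.val_castSucc, h, Finset.sum_add_distrib,
    Finset.sum_ite_eq', Finset.mem_univ, if_true]
  push_cast
  ring

lemma expAt_nonneg {n : Fin r → ℤ} (hn : ∀ s, 0 ≤ n s) (i : Fin (r + 1)) : 0 ≤ expAt n i := by
  refine add_nonneg (Int.natCast_nonneg _) (Finset.sum_nonneg fun s _ => ?_)
  split_ifs
  · exact hn s
  · exact le_rfl

lemma ext_of_lt (l : Fin r → ℤ) (k : ℤ) {j : ℕ} (hj : r < j) : ext l k j = 0 := by
  obtain ⟨j, rfl⟩ : ∃ t, j = t + 1 := ⟨j - 1, by omega⟩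
  exact dif_neg (by omega)

lemma ext_nonneg {m l : Fin r → ℤ} {k : ℤ} (h : Consistent m l k) (j : ℕ) : 0 ≤ ext l k j := by
  rcases j with _ | j
  · exact h.k_nonneg
  · rw [ext]
    split_ifs
    · exact h.l_nonneg _
    · exact le_rfl

lemma ext_add_ones (l : Fin r → ℤ) (k : ℤ) (i : Fin (r + 1)) (j : ℕ) :
    ext (l + ones i) (k + 1) j = ext l k j + if j ≤ i.val then 1 else 0 := by
  rcases j with _ | j
  · simp [ext]
  · have := i.isLt
    simp only [ext, ones, Pi.add_apply]
    split_ifs <;> omega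

lemma ext_sub_ones (l : Fin r → ℤ) (k : ℤ) (i : Fin (r + 1)) (j : ℕ) :
    ext (l - ones i) (k - 1) j = ext l k j - if j ≤ i.val then 1 else 0 := by
  have := ext_add_ones (l - ones i) (k - 1) i j
  rw [sub_add_cancel, sub_add_cancel] at this
  rw [this, add_sub_cancel_right]

lemma expInf_zero (m l : Fin r → ℤ) (k : ℤ) : expInf m l k 0 = ext l k 1 := by
  have h : ext l k 0 = k := rfl
  simp [expInf, h]

lemma exponentSet_eq {n : Fin r → ℤ} {a : Fin (r + 1) → ℕ} (ha : ∀ i, (a i : ℤ) = expAt n i) :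
    exponentSet n = Set.range fun i => (a i : ℤ) := by
  simp only [ha]
  rfl

lemma exponentSet_first (hr : 1 ≤ r) (k : ℕ) :
    exponentSet (fun s : Fin r => if s.val = 0 then (k : ℤ) else 0) =
      (Nat.cast : ℕ → ℤ) '' ↑(insert 0 (Finset.Ico (k + 1) (k + 1 + r))) := by
  have hval : ∀ i : Fin (r + 1), ((i.val : ℤ) + ∑ s : Fin r,
      if s.val < i.val then (if s.val = 0 then (k : ℤ) else 0) else 0) =
        i.val + if 0 < i.val then (k : ℤ) else 0 := by
    intro i
    rw [Finset.sum_eq_single ⟨0, hr⟩]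
    · simp
    · intro s _ hs
      rw [if_neg (show ¬s.val = 0 from fun h => hs (Fin.ext h)), ite_self]
    · simp
  ext z
  simp only [exponentSet, hval, Set.mem_range, Set.mem_image, Finset.mem_coe, Finset.mem_insert,
    Finset.mem_Ico]
  constructor
  · rintro ⟨i, rfl⟩
    have := i.isLt
    split_ifs with hi
    · exact ⟨i + k, Or.inr (by omega), by push_cast; ring⟩
    · exact ⟨0, Or.inl rfl, by omega⟩
  · rintro ⟨x, rfl | hx, rfl⟩
    · exact ⟨0, by simp⟩
    · refine ⟨⟨x - k, by omega⟩, ?_⟩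
      rw [if_pos (by simp only; omega)]
      simp only
      omega

lemma exponentSet_last (hr : 1 ≤ r) (k : ℕ) :
    exponentSet (fun s : Fin r => if s.val + 1 = r then (k : ℤ) else 0) =
      (Nat.cast : ℕ → ℤ) '' ↑(insert (k + r) (Finset.range r)) := by
  have hval : ∀ i : Fin (r + 1), ((i.val : ℤ) + ∑ s : Fin r,
      if s.val < i.val then (if s.val + 1 = r then (k : ℤ) else 0) else 0) =
        i.val + if i.val = r then (k : ℤ) else 0 := by
    intro i
    have := i.isLt
    rw [Finset.sum_eq_single ⟨r - 1, by omega⟩]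
    · simp only
      split_ifs <;> omega
    · intro s _ hs
      rw [if_neg (show ¬s.val + 1 = r from fun h => hs (Fin.ext (by simp only; omega))), ite_self]
    · simp
  ext z
  simp only [exponentSet, hval, Set.mem_range, Set.mem_image, Finset.mem_coe, Finset.mem_insert,
    Finset.mem_range]
  constructor
  · rintro ⟨i, rfl⟩
    have := i.isLt
    split_ifs with hi
    · exact ⟨k + r, Or.inl rfl, by push_cast; omega⟩
    · exact ⟨i, Or.inr (by omega), by ring⟩
  · rintro ⟨x, rfl | hx, rfl⟩
    · refine ⟨Fin.last r, ?_⟩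
      rw [Fin.val_last, if_pos rfl]
      push_cast
      ring
    · refine ⟨⟨x, by omega⟩, ?_⟩
      rw [if_neg (by simp only; omega), add_zero]

/-- The total gap `∑ (l_s - l_{s+1})` telescopes to `l_1`. The condition `l_s - l_{s+1} ≤ m_s` makes
the intervals non-empty, and the monotonicity of `l` keeps them apart. -/
lemma Consistent.exists_gapped {m l : Fin r → ℤ} {k : ℤ} (h : Consistent m l k) :
    ∃ (a : Fin (r + 1) → ℕ) (b : Fin r → ℕ) (l' k' : ℕ), (∀ i, (a i : ℤ) = expAt m i) ∧
      (∀ i : Fin r, (b i : ℤ) = expAt m i.succ - (ext l k (i + 1) - ext l k (i + 2))) ∧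
      (l' : ℤ) = ext l k 1 ∧ (k' : ℤ) = k ∧ Gapped a b l' k' := by
  have hb : ∀ i : Fin r, 0 ≤ expAt m i.succ - (ext l k (i + 1) - ext l k (i + 2)) := by
    intro i
    have := h.gap i
    have := expAt_nonneg h.m_nonneg i.castSucc
    rw [expAt_succ]
    omega
  choose a ha using fun i => Int.eq_ofNat_of_zero_le (expAt_nonneg h.m_nonneg i)
  choose b hb using fun i => Int.eq_ofNat_of_zero_le (hb i)
  obtain ⟨l', hl'⟩ := Int.eq_ofNat_of_zero_le (ext_nonneg h 1)
  obtain ⟨k', hk'⟩ := Int.eq_ofNat_of_zero_le h.k_nonneg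
  refine ⟨a, b, l', k', fun i => (ha i).symm, fun i => (hb i).symm, hl'.symm, hk'.symm, ?_⟩
  constructor
  · have := ha 0
    rw [expAt_zero] at this
    omega
  · intro i
    have h1 := h.gap i
    have h2 := hb i
    have h3 := ha i.castSucc
    rw [expAt_succ] at h2
    omega
  · intro i
    have h1 : ext l k (i + 2) ≤ ext l k (i + 1) := h.antitone (i + 1) i.isLt
    have h2 := hb i
    have h3 := ha i.succ
    omega
  · have h1 := h.antitone 0 (Nat.zero_le _)
    change ext l k 1 ≤ k at h1
    omega
  · zify
    simp only [← ha, ← hb, Finset.sum_sub_distrib]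
    have h1 := Finset.sum_range_sub' (fun j => ext l k (j + 1)) r
    rw [Finset.sum_range, ext_of_lt l k (Nat.lt_succ_self r), zero_add, hl',
      Finset.sum_sub_distrib] at h1
    linarith

theorem isV_iff (hr : 1 ≤ r) {m l : Fin r → ℤ} {k : ℤ} {a : Fin (r + 1) → ℕ} {b : Fin r → ℕ}
    {l' k' : ℕ} (ha : ∀ i, (a i : ℤ) = expAt m i)
    (hb : ∀ i : Fin r, (b i : ℤ) = expAt m i.succ - (ext l k (i + 1) - ext l k (i + 2)))
    (hl : (l' : ℤ) = ext l k 1) (hk : (k' : ℤ) = k) (h : Gapped a b l' k') {H p : ℂ[X]}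
    (hp : IsPadeGenerator a b l' k' H p) (V : Submodule ℂ ℂ[X]) :
    IsV m l k V ↔ V = padeSpace a b k' H p := by
  have hinf : expInf m l k = fun i => (padeDegrees b l' k' i : ℤ) := by
    ext i
    obtain rfl | ⟨i, rfl⟩ := Fin.eq_zero_or_eq_succ i
    · rw [padeDegrees, Fin.cons_zero, hl, expInf_zero]
    · rw [padeDegrees, Fin.cons_succ]
      push_cast
      rw [hb, hk, expInf, expAt]
      simp only [Fin.val_succ]
      ring
  rw [IsV, exponentSet_eq ha, hinf, ← hk, exponentSet_first hr]
  constructor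
  · intro hV
    refine hp.eq_padeSpace h hV.finrank_eq ?_ ?_ ?_
    · refine Nat.cast_injective.image_injective ((exponentsAt_eq V 0).symm.trans ?_)
      rw [hV.exponents_zero, finset_coe_image_eq a _ rfl]
    · have := Nat.cast_injective.image_injective
        ((exponentsAt_eq V 1).symm.trans hV.exponents_one)
      rw [this]
      intro n hn hn0
      rcases Finset.mem_insert.mp hn with h' | h'
      · exact absurd h' hn0
      · exact (Finset.mem_Ico.mp h').1
    · refine Nat.cast_injective.image_injective ((exponentsAtInfinity_eq V).symm.trans ?_)
      rw [hV.exponents_infinity, finset_coe_image_eq _ _ rfl]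
  · rintro rfl
    exact hp.isTwoPointSpace h

lemma expInfDual_eq (m l : Fin r → ℤ) (k : ℤ) (i : Fin (r + 1)) :
    expInfDual m l k i =
      expAt (fun s => m s.rev) i + (ext l k (r - i) - ext l k (r - i + 1)) := by
  have h : (∑ s : Fin r, if r + 1 - i.val ≤ s.val + 1 then m s else 0) =
      ∑ s : Fin r, if s.val < i.val then m s.rev else 0 := by
    rw [← Equiv.sum_comp Fin.revPerm]
    refine Finset.sum_congr rfl fun s _ => ?_
    rw [Fin.revPerm_apply, Fin.val_rev]
    have := i.isLt
    have := s.isLt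
    exact if_congr (by omega) rfl rfl
  rw [expInfDual, h, expAt]
  ring

/-- Here `b_i - a_i = l_{r-i} - l_{r-i+1}`, which telescopes to `l_0 = k`. Monotonicity of `l` gives
`a_i ≤ b_i`, and the gap condition separates consecutive blocks. -/
lemma Consistent.exists_interlaced {m l : Fin r → ℤ} {k : ℤ} (h : Consistent m l k) :
    ∃ (a b : Fin (r + 1) → ℕ) (k' : ℕ), (∀ i, (a i : ℤ) = expAt (fun s => m s.rev) i) ∧
      (∀ i, (b i : ℤ) = expInfDual m l k i) ∧ (k' : ℤ) = k ∧ Interlaced a b k' := by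
  have hA : ∀ i, 0 ≤ expAt (fun s => m s.rev) i := expAt_nonneg fun s => h.m_nonneg s.rev
  have hle : ∀ i : Fin (r + 1), ext l k (r - i + 1) ≤ ext l k (r - i) := fun i =>
    h.antitone _ (Nat.sub_le _ _)
  have hb : ∀ i, 0 ≤ expInfDual m l k i := by
    intro i
    have := hle i
    have := hA i
    rw [expInfDual_eq]
    omega
  choose a ha using fun i => Int.eq_ofNat_of_zero_le (hA i)
  choose b hb using fun i => Int.eq_ofNat_of_zero_le (hb i)
  obtain ⟨k', hk'⟩ := Int.eq_ofNat_of_zero_le h.k_nonneg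
  have hab : ∀ i, a i ≤ b i := by
    intro i
    have h1 := hle i
    have h2 := ha i
    have h3 := hb i
    rw [expInfDual_eq] at h3
    omega
  have hba : ∀ i : Fin r, b i.castSucc < a i.succ := by
    intro i
    have h1 := h.gap i.rev
    have h2 := ha i.succ
    have h3 := hb i.castSucc
    rw [expInfDual_eq] at h3
    rw [expAt_succ] at h2
    rw [Fin.val_rev, show r - (i.val + 1) + 1 = r - i.val by omega,
      show r - (i.val + 1) + 2 = r - i.val + 1 by omega] at h1
    rw [Fin.val_castSucc] at h3
    omega
  have hmono : StrictMono a := Fin.strictMono_iff_lt_succ.mpr fun i => (hab _).trans_lt (hba i)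
  refine ⟨a, b, k', fun i => (ha i).symm, fun i => (hb i).symm, hk'.symm, hab, ?_, ?_⟩
  · intro i j hij
    obtain ⟨i, rfl⟩ := Fin.exists_castSucc_eq.mpr (hij.trans_le (Fin.le_last _)).ne
    exact (hba i).trans_le (hmono.monotone (Fin.castSucc_lt_iff_succ_le.mp hij))
  · zify
    simp only [← ha, ← hb, ← hk', expInfDual_eq, Finset.sum_add_distrib]
    congr 1
    rw [← Equiv.sum_comp Fin.revPerm]
    have h1 := Finset.sum_range_sub' (fun j => ext l k j) (r + 1)
    rw [Finset.sum_range, ext_of_lt l k (Nat.lt_succ_self r), sub_zero] at h1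
    refine (Finset.sum_congr rfl fun i _ => ?_).trans h1
    have := i.isLt
    rw [Fin.revPerm_apply, Fin.val_rev, show r - (r + 1 - (i.val + 1)) = i.val by omega]

theorem isU_iff (hr : 1 ≤ r) {m l : Fin r → ℤ} {k : ℤ} {a b : Fin (r + 1) → ℕ}
    {k' : ℕ} (ha : ∀ i, (a i : ℤ) = expAt (fun s => m s.rev) i)
    (hb : ∀ i, (b i : ℤ) = expInfDual m l k i) (hk : (k' : ℤ) = k) (h : Interlaced a b k')
    {g : ℂ[X]} (hg : IsBlockGenerator a b k' g) (U : Submodule ℂ ℂ[X]) :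
    IsU m l k U ↔ U = blockSpace a b g := by
  have hinf : expInfDual m l k = fun i => (b i : ℤ) := funext fun i => (hb i).symm
  rw [IsU, exponentSet_eq ha, hinf, ← hk, exponentSet_last hr]
  constructor
  · intro hU
    refine hg.eq_blockSpace h hU.finrank_eq ?_ ?_ ?_
    · refine Nat.cast_injective.image_injective ((exponentsAt_eq U 0).symm.trans ?_)
      rw [hU.exponents_zero, finset_coe_image_eq a _ rfl]
    · have := Nat.cast_injective.image_injective
        ((exponentsAt_eq U 1).symm.trans hU.exponents_one)
      rw [this]
      exact Finset.mem_insert_self _ _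
    · refine Nat.cast_injective.image_injective ((exponentsAtInfinity_eq U).symm.trans ?_)
      rw [hU.exponents_infinity, finset_coe_image_eq b _ rfl]
  · rintro rfl
    exact hg.isTwoPointSpace h

end Parameters

/-! ### The two isomorphisms. -/

section Main

variable {r : ℕ} {m l : Fin r → ℤ} {k : ℤ} {i : Fin (r + 1)}

theorem isV_add_ones (hr : 1 ≤ r) (h : Consistent m l k)
    (h' : Consistent m (l + ones i) (k + 1)) :
    (∃! V, IsV m l k V) ∧ (∃! V', IsV m (l + ones i) (k + 1) V') ∧
      ∀ V V' : Submodule ℂ ℂ[X], IsV m l k V → IsV m (l + ones i) (k + 1) V' →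
        ∃ φ : V ≃ₗ[ℂ] V', ∀ f : V, (φ f : ℂ[X]) = D m l k i (f : ℂ[X]) := by
  obtain ⟨a, b, q, t, ha, hb, hq, ht, hg⟩ := h.exists_gapped
  obtain ⟨a', b', q', t', ha', hb', hq', ht', hg'⟩ := h'.exists_gapped
  obtain rfl : a = a' := funext fun j => Nat.cast_injective ((ha j).trans (ha' j).symm)
  obtain rfl : t' = t + 1 := by omega
  obtain ⟨H, p, hp⟩ := hg.exists_isPadeGenerator
  obtain ⟨he, he'⟩ : (∀ j n, a j.castSucc ≤ n →
      (n < b' j ↔ n < b j ∧ (n : ℂ) ≠ (expInf m l k i : ℂ) - t - 1)) ∧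
      (q' = q + 1 ∨ q' = q ∧ (expInf m l k i : ℂ) = q) := by
    have hbb : ∀ j : Fin r, (b' j : ℤ) = b j - if i.val = j + 1 then 1 else 0 := by
      intro j
      rw [hb', hb, ext_add_ones, ext_add_ones]
      split_ifs <;> omega
    rw [ext_add_ones] at hq'
    have hcast : ∀ n : ℕ, (n : ℂ) ≠ (expInf m l k i : ℂ) - t - 1 ↔
        (n : ℤ) ≠ expInf m l k i - t - 1 := by
      intro n
      rw [not_iff_not]
      exact_mod_cast Iff.rfl
    simp only [hcast]
    have hqt := hg.l_le
    -- For index 0, `e_0 = l_1` is the degree of `p`, and `e_0 - k - 1` is negative, so no interval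
    -- changes. For a positive index, `e - k - 1` is the last exponent of the corresponding
    -- interval.
    obtain rfl | ⟨i, rfl⟩ := Fin.eq_zero_or_eq_succ i
    · have hE : expInf m l k 0 = q := by rw [hq, expInf_zero]
      refine ⟨fun j n hn => ?_, Or.inr ⟨?_, by rw [hE]; simp⟩⟩
      · have := hbb j
        rw [Fin.val_zero, if_neg (by omega)] at this
        omega
      · rw [Fin.val_zero, if_neg (by omega)] at hq'
        omega
    · have hE : expInf m l k i.succ = b i + t := by
        rw [hb, ht, expInf, expAt]
        simp only [Fin.val_succ]
        ring
      refine ⟨fun j n hn => ?_, Or.inl ?_⟩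
      · have := hbb j
        have hj := hg.lt j
        have hi := hg.lt i
        rw [Fin.val_succ] at this
        split_ifs at this with hij
        · obtain rfl : i = j := Fin.ext (by omega)
          omega
        · have hne : n < b j → n ≠ b i - 1 := by
            rintro hnj rfl
            exact hij (by rw [hg.eq_of_mem (i := i) (j := j) (by omega) (by omega) hn hnj])
          omega
      · rw [Fin.val_succ, if_pos (by omega)] at hq'
        omega
  obtain ⟨hp', hmap⟩ := map_padeOp_padeSpace hr hg hg' _ he he' hp
  have iff := isV_iff hr ha hb hq ht hg hp
  have iff' := isV_iff hr ha hb' hq' ht' hg' hp'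
  refine ⟨⟨_, (iff _).mpr rfl, fun V hV => (iff V).mp hV⟩,
    ⟨_, (iff' _).mpr rfl, fun V hV => (iff' V).mp hV⟩, fun V V' hV hV' => ?_⟩
  obtain rfl := (iff V).mp hV
  obtain rfl := (iff' V').mp hV'
  obtain ⟨φ, hφ⟩ := exists_linearEquiv_of_map_eq _ hmap
    ((hp.finrank_padeSpace hg).trans (hp'.finrank_padeSpace hg').symm)
  refine ⟨φ, fun f => (hφ f).trans ?_⟩
  rw [D, padeOp, ← ht, Int.cast_natCast]

theorem isU_sub_ones (hr : 1 ≤ r) (h' : Consistent m (l - ones i) (k - 1))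
    (h : Consistent m l k) :
    (∃! U, IsU m l k U) ∧ (∃! U', IsU m (l - ones i) (k - 1) U') ∧
      ∀ U U' : Submodule ℂ ℂ[X], IsU m l k U → IsU m (l - ones i) (k - 1) U' →
        ∃ φ : U ≃ₗ[ℂ] U', ∀ f : U, (φ f : ℂ[X]) = DDual m l k i (f : ℂ[X]) := by
  obtain ⟨a, b, t, ha, hb, ht, hg⟩ := h.exists_interlaced
  obtain ⟨a', b', t', ha', hb', ht', hg'⟩ := h'.exists_interlaced
  obtain rfl : a = a' := funext fun j => Nat.cast_injective ((ha j).trans (ha' j).symm)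
  obtain rfl : t = t' + 1 := by omega
  obtain ⟨g, hgen⟩ := hg.exists_isBlockGenerator
  -- Subtracting `1_i` and lowering `k` by one changes `l_0, …, l_i` by one, so only the difference
  -- `l_i - l_{i+1}` changes. It is the length of the block with index `r - i`.
  have hbb : ∀ j, b j = b' j + if j = i.rev then 1 else 0 := by
    intro j
    have h1 := hb j
    have h2 := hb' j
    have hi := i.isLt
    have hj := j.isLt
    rw [expInfDual_eq] at h1 h2
    rw [ext_sub_ones, ext_sub_ones] at h2
    have hji : j = i.rev ↔ j.val = r - i.val := by
      rw [Fin.ext_iff, Fin.val_rev]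
      omega
    simp only [hji]
    split_ifs at h2 ⊢ <;> omega
  obtain ⟨hgen', hmap⟩ := map_theta_blockSpace hg b' hbb hgen (hg'.le i.rev)
  have iff := isU_iff hr ha hb ht hg hgen
  have iff' := isU_iff hr ha hb' ht' hg' hgen'
  refine ⟨⟨_, (iff _).mpr rfl, fun U hU => (iff U).mp hU⟩,
    ⟨_, (iff' _).mpr rfl, fun U hU => (iff' U).mp hU⟩, fun U U' hU hU' => ?_⟩
  obtain rfl := (iff U).mp hU
  obtain rfl := (iff' U').mp hU'
  obtain ⟨φ, hφ⟩ := exists_linearEquiv_of_map_eq _ hmap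
    ((hgen.finrank_blockSpace hg).trans (hgen'.finrank_blockSpace hg').symm)
  refine ⟨φ, fun f => (hφ f).trans ?_⟩
  have hc : (b i.rev : ℤ) = (∑ s : Fin r, if i.val < s.val + 1 then m s else 0)
      - ext l k (i.val + 1) + ext l k i.val + ((r : ℤ) - i.val) := by
    have hi := i.isLt
    rw [hb, expInfDual, Fin.val_rev]
    simp only [show r + 1 - (r + 1 - (i.val + 1)) = i.val + 1 by omega, Nat.succ_le_iff,
      show r - (r + 1 - (i.val + 1)) = i.val by omega]
    rw [show r + 1 - (i.val + 1) = r - i.val by omega, Nat.cast_sub (by omega)]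
  rw [DDual, ← hc, theta, Int.cast_natCast]

end Main

end TwoPoint

end

theorem mainTheorem3 (r : ℕ) (hr : 1 ≤ r) (m : Fin r → ℤ) :
    (∀ (l : Fin r → ℤ) (k : ℤ) (i : Fin (r + 1)),
      TwoPoint.Consistent m l k →
      TwoPoint.Consistent m (l + TwoPoint.ones i) (k + 1) →
        (∃! V : Submodule ℂ ℂ[X], TwoPoint.IsV m l k V) ∧
        (∃! V' : Submodule ℂ ℂ[X], TwoPoint.IsV m (l + TwoPoint.ones i) (k + 1) V') ∧
        ∀ V V' : Submodule ℂ ℂ[X],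
          TwoPoint.IsV m l k V → TwoPoint.IsV m (l + TwoPoint.ones i) (k + 1) V' →
            ∃ φ : V ≃ₗ[ℂ] V', ∀ f : V, (φ f : ℂ[X]) = TwoPoint.D m l k i (f : ℂ[X])) ∧
    (∀ (l : Fin r → ℤ) (k : ℤ) (i : Fin (r + 1)),
      TwoPoint.Consistent m (l - TwoPoint.ones i) (k - 1) →
      TwoPoint.Consistent m l k →
        (∃! U : Submodule ℂ ℂ[X], TwoPoint.IsU m l k U) ∧
        (∃! U' : Submodule ℂ ℂ[X], TwoPoint.IsU m (l - TwoPoint.ones i) (k - 1) U') ∧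
        ∀ U U' : Submodule ℂ ℂ[X],
          TwoPoint.IsU m l k U → TwoPoint.IsU m (l - TwoPoint.ones i) (k - 1) U' →
            ∃ φ : U ≃ₗ[ℂ] U', ∀ f : U, (φ f : ℂ[X]) = TwoPoint.DDual m l k i (f : ℂ[X])) := by
  exact ⟨fun _ _ _ h h' => TwoPoint.isV_add_ones hr h h',
    fun _ _ _ h' h => TwoPoint.isU_sub_ones hr h' h⟩
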